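/- **Theorem 1′.** Let $B$ be a connected finite-dimensional manifold (Hausdorff, second countable, without boundary) and $\varphi=(\varphi_t)_{t\in\mathbb R}$ a flow on $B$ which admits an ergodic invariant probability measure $\lambda$ that is absolutely continuous, with strictly positive density, with respect to Lebesgue measure. Let $n\ge 1$ and let $\tilde\rho:\pi_1(B)\to GL(n,\mathbb C)$ be a representation, with projectivisation $\rho:\pi_1(B)\to PGL(n,\mathbb C)$. Let $E=(\tilde B\times\mathbb C^n)/\pi_1(B)$ be the flat vector bundle obtained by suspending $\tilde\rho$ ($\tilde B$ is the universal cover and $\gamma\cdot(b,w)=(\gamma b,\tilde\rho(\gamma)w)$), and $M_\rho=(\tilde B\times\mathbb C P^{n-1})/\pi_1(B)=\mathrm{Proj}(E)$ the suspension of $\rho$, foliated by the images of the sets $\tilde B\times\{\ell\}$. Let $\tilde\Phi$ on $E$ and $\Phi$ on $M_\rho$ be the lifts of $\varphi$ to the leaves: $\tilde\Phi_t[b,w]=[\tilde\varphi_t b,w]$ and $\Phi_t[b,\ell]=[\tilde\varphi_t b,\ell]$, where $\tilde\varphi$ is the lift of $\varphi$ to $\tilde B$. Let $|\cdot|_x$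 be a continuous Hermitian metric on $E$. Suppose that $E$ admits a section $\sigma^+$ of largest expansion, that is: there are a $\varphi$-invariant set $\mathcal A\subset B$ with Lebesgue-null complement and a measurable splitting $E_x=F_x\oplus G_x$, $x\in\mathcal A$, with $\dim F_x=1$ and $\tilde\Phi_t(F_x)=F_{\varphi_t(x)}$, $\tilde\Phi_t(G_x)=G_{\varphi_t(x)}$ for all $t\in\mathbb R$, such that for every $x\in\mathcal A$, every compact set $K\subset B$, every sequence $t_k\to+\infty$ with $\varphi_{t_k}(x)\in K$ for all $k$, and all non-zero $w_1\in F_x$, $w_2\in G_x$, $$\lim_{k\to\infty}\frac{|\tilde\Phi_{t_k}(w_1)|_{\varphi_{t_k}(x)}}{|\tilde\Phi_{t_k}(w_2)|_{\varphi_{t_k}(x)}}=+\infty ;$$ and $\sigma^+(x)\in\mathrm{Proj}(E_x)$ is the point given by the line $F_x$, for $x\in\mathcal A$. Then $\sigma^+_*\lambda$ is an SRB-measure of $\Phi$, that is, a $\Phi$-invariant probability measure on $M_\rho$ whose basin $$\Big\{y\in M_\rho:\ \lim_{T\to+\infty}\frac1T\int_0^T h(\Phi_t(y))\,dt=\int_{M_\rho}h\,d(\sigma^+_*\lambda)\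 \text{ for every continuous } h:M_\rho\to\mathbb R \text{ with compact support}\Big\}$$ is not Lebesgue null; moreover the basin has total Lebesgue measure, i.e. its complement in $M_\rho$ is Lebesgue null. -/

import Mathlib

open Set Filter Topology MeasureTheory
open scoped ComplexOrder Manifold LinearAlgebra.Projectivization MatrixGroups

noncomputable section

/-! ### Lebesgue measure class, basins and SRB measures -/

section Measure

/-- A subset of a manifold modelled on `H` is Lebesgue null if its image in every chart of the
atlas is a null set. -/
def LebesgueNull (H : Type*) [TopologicalSpace H] [MeasureSpace H] {M : Type*}
    [TopologicalSpace M] [ChartedSpace H M] (s : Set M) : Prop :=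
  ∀ e ∈ atlas H M, volume (e '' (s ∩ e.source)) = 0

/-- In every chart, `μ` has a strictly positive density with respect to Lebesgue measure. -/
def HasPositiveDensity (H : Type*) [TopologicalSpace H] [MeasureSpace H] {M : Type*}
    [TopologicalSpace M] [ChartedSpace H M] [MeasurableSpace M] (μ : Measure M) : Prop :=
  ∀ e ∈ atlas H M, ∃ f : H → ENNReal, Measurable f ∧ (∀ y ∈ e.target, 0 < f y) ∧
    (μ.restrict e.source).map e = (volume.restrict e.target).withDensity f

/-- `μ` is invariant under the flow `φ` and every invariant measurable set is trivial. -/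
structure IsErgodicInvariant {M : Type*} [MeasurableSpace M] (φ : ℝ → M → M)
    (μ : Measure M) : Prop where
  invariant : ∀ t, MeasurePreserving (φ t) μ μ
  ergodic : ∀ s, MeasurableSet s → (∀ t, φ t ⁻¹' s = s) → μ s = 0 ∨ μ sᶜ = 0

/-- The basin of `μ`: the points whose positive time averages converge to the integral against `μ`
for every continuous function with compact support. -/
def basin {M : Type*} [TopologicalSpace M] [MeasurableSpace M] (φ : ℝ → M → M)
    (μ : Measure M) : Set M :=
  {x | ∀ h : M → ℝ, Continuous h → HasCompactSupport h →
    Tendsto (fun T : ℝ => (1 / T) * ∫ t in (0 : ℝ)..T, h (φ t x)) atTop (𝓝 (∫ y, h y ∂μ))}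

/-- An SRB measure: an invariant probability measure whose basin is not Lebesgue null. -/
structure IsSRBMeasure (H : Type*) [TopologicalSpace H] [MeasureSpace H] {M : Type*}
    [TopologicalSpace M] [ChartedSpace H M] [MeasurableSpace M] (φ : ℝ → M → M)
    (μ : Measure M) : Prop where
  isProbabilityMeasure : IsProbabilityMeasure μ
  invariant : ∀ t, MeasurePreserving (φ t) μ μ
  basin_not_null : ¬ LebesgueNull H (basin φ μ)

end Measure

/-! ### The universal cover -/

section Cover

variable {B : Type*} [TopologicalSpace B]

/-- The universal cover of `B`: homotopy classes (with fixed ends) of paths issuing from `x₀`. -/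
structure UniversalCover (B : Type*) [TopologicalSpace B] (x₀ : B) where
  /-- the end point, that is the image under the covering projection -/
  pt : B
  /-- the class of the path -/
  cls : Path.Homotopic.Quotient x₀ pt

namespace UniversalCover

variable {x₀ : B}

/-- The classes obtained by prolonging `b` by a path inside `V`. -/
def nhd (V : Set B) (b : UniversalCover B x₀) : Set (UniversalCover B x₀) :=
  {c | ∃ δ : Path b.pt c.pt, (∀ t, δ t ∈ V) ∧ c.cls = b.cls.trans (.mk δ)}

theorem nhd_mono {V W : Set B} (h : V ⊆ W) (b : UniversalCover B x₀) : nhd V b ⊆ nhd W b :=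
  fun _ ⟨δ, h1, h2⟩ => ⟨δ, fun t => h (h1 t), h2⟩

/-- The topology having the sets `nhd V b`, for `V` an open neighbourhood of the end point of `b`,
as a neighbourhood basis at `b`. -/
instance : TopologicalSpace (UniversalCover B x₀) where
  IsOpen s := ∀ b ∈ s, ∃ V, IsOpen V ∧ b.pt ∈ V ∧ nhd V b ⊆ s
  isOpen_univ _ _ := ⟨univ, isOpen_univ, mem_univ _, subset_univ _⟩
  isOpen_inter s t hs ht b hb := by
    obtain ⟨V, hV, hbV, h⟩ := hs b hb.1
    obtain ⟨W, hW, hbW, h'⟩ := ht b hb.2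
    exact ⟨V ∩ W, hV.inter hW, ⟨hbV, hbW⟩, subset_inter
      ((nhd_mono inter_subset_left b).trans h) ((nhd_mono inter_subset_right b).trans h')⟩
  isOpen_sUnion S hS b hb := by
    obtain ⟨s, hs, hbs⟩ := hb
    obtain ⟨V, hV, hbV, h⟩ := hS s hs b hbs
    exact ⟨V, hV, hbV, h.trans (subset_sUnion_of_mem hs)⟩

theorem isOpen_def {s : Set (UniversalCover B x₀)} :
    IsOpen s ↔ ∀ b ∈ s, ∃ V, IsOpen V ∧ b.pt ∈ V ∧ nhd V b ⊆ s := Iff.rfl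

/-- The deck transformations. In Mathlib `g * h` is the class of `h` followed by `g`, so that a left
action is obtained by letting `g` act by preceding a path by the loop `g⁻¹`. -/
instance : MulAction (FundamentalGroup B x₀) (UniversalCover B x₀) where
  smul g b := ⟨b.pt, (FundamentalGroup.toPath g⁻¹).trans b.cls⟩
  one_smul b := by
    rcases b with ⟨x, γ⟩
    change UniversalCover.mk x _ = _
    rw [inv_one, FundamentalGroup.one_def]
    congr 1
    exact Path.Homotopic.Quotient.refl_trans γ
  mul_smul g h b := by
    rcases b with ⟨x, γ⟩
    change UniversalCover.mk x _ = UniversalCover.mk x _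
    rw [mul_inv_rev, FundamentalGroup.mul_def]
    congr 1
    exact Path.Homotopic.Quotient.trans_assoc _ _ _

theorem smul_def (g : FundamentalGroup B x₀) (b : UniversalCover B x₀) :
    g • b = ⟨b.pt, (FundamentalGroup.toPath g⁻¹).trans b.cls⟩ := rfl

@[simp] theorem smul_pt (g : FundamentalGroup B x₀) (b : UniversalCover B x₀) :
    (g • b).pt = b.pt := rfl

theorem eq_of_smul_eq {g : FundamentalGroup B x₀} {b : UniversalCover B x₀} (h : g • b = b) :
    g = 1 := by
  rcases b with ⟨x, γ⟩
  rw [smul_def, UniversalCover.mk.injEq] at h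
  have h1 := eq_of_heq h.2
  have h2 := congrArg (fun c => Path.Homotopic.Quotient.trans c γ.symm) h1
  simp only [Path.Homotopic.Quotient.trans_assoc, Path.Homotopic.Quotient.trans_symm,
    Path.Homotopic.Quotient.trans_refl] at h2
  have h3 : g⁻¹ = 1 := h2
  exact inv_eq_one.mp h3

theorem exists_smul_eq {b c : UniversalCover B x₀} (h : b.pt = c.pt) :
    ∃ g : FundamentalGroup B x₀, c = g • b := by
  rcases b with ⟨x, γ⟩
  rcases c with ⟨y, η⟩
  obtain rfl : x = y := h
  let k : FundamentalGroup B x₀ := FundamentalGroup.fromPath (η.trans γ.symm)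
  refine ⟨k⁻¹, ?_⟩
  rw [smul_def, inv_inv]
  congr 1
  change η = (η.trans γ.symm).trans γ
  simp only [Path.Homotopic.Quotient.trans_assoc, Path.Homotopic.Quotient.symm_trans,
    Path.Homotopic.Quotient.trans_refl]

instance : ContinuousConstSMul (FundamentalGroup B x₀) (UniversalCover B x₀) where
  continuous_const_smul g := by
    refine continuous_def.2 fun s hs b hb => ?_
    obtain ⟨V, hV, hbV, h⟩ := hs (g • b) hb
    refine ⟨V, hV, hbV, fun c hc => h ?_⟩
    obtain ⟨δ, h1, h2⟩ := hc
    refine ⟨δ, h1, ?_⟩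
    change (FundamentalGroup.toPath g⁻¹).trans c.cls
      = ((FundamentalGroup.toPath g⁻¹).trans b.cls).trans _
    rw [h2, Path.Homotopic.Quotient.trans_assoc]

/-- A class of paths ending at each point of a path connected space. -/
theorem exists_pt_eq [PathConnectedSpace B] (x : B) : ∃ b : UniversalCover B x₀, b.pt = x :=
  ⟨⟨x, .mk (PathConnectedSpace.somePath x₀ x)⟩, rfl⟩

/-- The piece of orbit `s ↦ φ (s t) x`, `0 ≤ s ≤ 1`. -/
def orbitPath (φ : Flow ℝ B) (t : ℝ) (x : B) : Path x (φ t x) where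
  toFun s := φ (s * t) x
  continuous_toFun := by fun_prop
  source' := by simp
  target' := by simp

/-- The lift of a flow to the universal cover: prolong a path by the orbit of its end point. -/
def flow (φ : Flow ℝ B) (t : ℝ) (b : UniversalCover B x₀) : UniversalCover B x₀ :=
  ⟨φ t b.pt, b.cls.trans (.mk (orbitPath φ t b.pt))⟩

theorem flow_smul (φ : Flow ℝ B) (t : ℝ) (g : FundamentalGroup B x₀) (b : UniversalCover B x₀) :
    flow φ t (g • b) = g • flow φ t b := by
  rw [smul_def, smul_def]
  simp only [flow, Path.Homotopic.Quotient.trans_assoc]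

end UniversalCover

end Cover

/-! ### Suspensions -/

section Susp

variable {B : Type*} [TopologicalSpace B] {x₀ : B} {Q : Type*} [Group Q]

/-- `(b, y) ∼ (γ b, ρ(γ) y)` for `γ` in the fundamental group. -/
def suspensionSetoid (ρ : FundamentalGroup B x₀ →* Q) (X : Type*) [MulAction Q X] :
    Setoid (UniversalCover B x₀ × X) where
  r p q := ∃ g : FundamentalGroup B x₀, q = (g • p.1, ρ g • p.2)
  iseqv :=
    { refl := fun p => ⟨1, by rw [map_one, one_smul, one_smul]⟩
      symm := by
        rintro p q ⟨g, rfl⟩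
        exact ⟨g⁻¹, by simp⟩
      trans := by
        rintro p q r ⟨g, rfl⟩ ⟨h, rfl⟩
        exact ⟨h * g, by rw [map_mul, mul_smul, mul_smul]⟩ }

/-- The suspension of a representation `ρ` of the fundamental group acting on `X`: the quotient of
(universal cover) `× X` by the diagonal action. Its foliation is the one whose leaves are the images
of (universal cover) `× {y}`. -/
def Suspension (ρ : FundamentalGroup B x₀ →* Q) (X : Type*) [MulAction Q X] : Type _ :=
  Quotient (suspensionSetoid ρ X)

namespace Suspension

variable {X : Type*} [MulAction Q X] {ρ : FundamentalGroup B x₀ →* Q}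

variable (ρ) in
/-- The class of `(b, y)`. -/
def mk (b : UniversalCover B x₀) (y : X) : Suspension ρ X :=
  Quotient.mk (suspensionSetoid ρ X) (b, y)

/-- The quotient topology. -/
instance [TopologicalSpace X] : TopologicalSpace (Suspension ρ X) :=
  .coinduced (fun p : UniversalCover B x₀ × X => mk ρ p.1 p.2) instTopologicalSpaceProd

instance [TopologicalSpace X] : MeasurableSpace (Suspension ρ X) := borel _

instance [TopologicalSpace X] : BorelSpace (Suspension ρ X) := ⟨rfl⟩

theorem mk_eq_mk {b c : UniversalCover B x₀} {y z : X} :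
    mk ρ b y = mk ρ c z ↔ ∃ g : FundamentalGroup B x₀, c = g • b ∧ z = ρ g • y := by
  refine Quotient.eq.trans ?_
  exact exists_congr fun g => Prod.ext_iff

theorem exists_mk (e : Suspension ρ X) : ∃ b y, mk ρ b y = e := by
  obtain ⟨⟨b, y⟩, h⟩ := Quotient.exists_rep e
  exact ⟨b, y, h⟩

/-- The projection to the base. -/
def proj : Suspension ρ X → B :=
  Quotient.lift (fun p => p.1.pt) (by rintro p q ⟨g, rfl⟩; rfl)

@[simp] theorem proj_mk (b : UniversalCover B x₀) (y : X) : proj (mk ρ b y) = b.pt := rfl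

/-- The lift of a flow of the base to the leaves of the suspension foliation: the image in the
quotient of the flow which moves the universal cover and fixes the second coordinate. -/
def flow (φ : Flow ℝ B) (t : ℝ) : Suspension ρ X → Suspension ρ X :=
  Quotient.map (fun p => (UniversalCover.flow φ t p.1, p.2)) (by
    rintro p q ⟨g, rfl⟩
    exact ⟨g, by simp [UniversalCover.flow_smul]⟩)

@[simp] theorem flow_mk (φ : Flow ℝ B) (t : ℝ) (b : UniversalCover B x₀) (y : X) :
    flow φ t (mk ρ b y) = mk ρ (UniversalCover.flow φ t b) y := rfl

@[simp] theorem proj_flow (φ : Flow ℝ B) (t : ℝ) (e : Suspension ρ X) :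
    proj (flow φ t e) = φ t (proj e) := by
  obtain ⟨b, y, rfl⟩ := exists_mk e
  rfl

theorem isOpenMap_mk [TopologicalSpace X] [ContinuousConstSMul Q X] :
    IsOpenMap (fun p : UniversalCover B x₀ × X => mk ρ p.1 p.2) := by
  intro U hU
  refine isOpen_coinduced.2 ?_
  have : (fun p : UniversalCover B x₀ × X => mk ρ p.1 p.2) ⁻¹' ((fun p => mk ρ p.1 p.2) '' U)
      = ⋃ g : FundamentalGroup B x₀, (fun p => (g • p.1, ρ g • p.2)) ⁻¹' U := by
    ext ⟨c, z⟩
    simp only [mem_preimage, mem_iUnion]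
    constructor
    · rintro ⟨⟨b, y⟩, hp, h⟩
      obtain ⟨g, rfl, rfl⟩ := mk_eq_mk.1 h
      exact ⟨g⁻¹, by simpa using hp⟩
    · rintro ⟨g, hg⟩
      exact ⟨_, hg, (mk_eq_mk.2 ⟨g, rfl, rfl⟩).symm⟩
  rw [this]
  exact isOpen_iUnion fun g => hU.preimage (by fun_prop)

theorem continuous_mk [TopologicalSpace X] :
    Continuous (fun p : UniversalCover B x₀ × X => mk ρ p.1 p.2) := continuous_coinduced_rng

end Suspension

end Susp

/-! ### Projective space -/

section Proj

variable {m : ℕ}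

/-- The quotient topology. -/
instance : TopologicalSpace (ℙ ℂ (Fin (m + 1) → ℂ)) :=
  .coinduced (Projectivization.mk' ℂ) instTopologicalSpaceSubtype

instance : ContinuousConstSMul (GL (Fin (m + 1)) ℂ) (ℙ ℂ (Fin (m + 1) → ℂ)) where
  continuous_const_smul g := by
    refine continuous_coinduced_dom.2 ?_
    have : Continuous fun v : {v : Fin (m + 1) → ℂ // v ≠ 0} =>
        (⟨g • v.1, (smul_ne_zero_iff_ne g).2 v.2⟩ : {v : Fin (m + 1) → ℂ // v ≠ 0}) :=
      Continuous.subtype_mk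
        ((Continuous.matrix_mulVec continuous_const continuous_id).comp continuous_subtype_val) _
    exact continuous_coinduced_rng.comp this

instance : ContinuousConstSMul PGL(Fin (m + 1), ℂ) (ℙ ℂ (Fin (m + 1) → ℂ)) where
  continuous_const_smul g := by
    cases g with
    | mk g => exact continuous_const_smul g

theorem insertNth_one_ne_zero (i : Fin (m + 1)) (z : Fin m → ℂ) :
    (i.insertNth (α := fun _ => ℂ) 1 z) ≠ 0 := fun h => by
  simpa using congrFun h i

/-- The affine coordinates `z ↦ [z₁ : … : 1 : … : zₘ]` with `1` in position `i`. -/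
def affineParam (i : Fin (m + 1)) (z : Fin m → ℂ) : ℙ ℂ (Fin (m + 1) → ℂ) :=
  .mk ℂ (i.insertNth (α := fun _ => ℂ) 1 z) (insertNth_one_ne_zero i z)

theorem affineParam_eq_mk {i : Fin (m + 1)} {z : Fin m → ℂ} {v : Fin (m + 1) → ℂ} {hv : v ≠ 0} :
    affineParam i z = .mk ℂ v hv ↔ v i ≠ 0 ∧ z = fun j => v (i.succAbove j) / v i := by
  rw [affineParam, eq_comm, Projectivization.mk_eq_mk_iff']
  constructor
  · rintro ⟨a, rfl⟩
    have ha : a ≠ 0 := by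
      rintro rfl
      simp at hv
    simp [ha]
  · rintro ⟨h, rfl⟩
    refine ⟨v i, ?_⟩
    ext j
    refine Fin.succAboveCases i ?_ (fun j => ?_) j
    · simp
    · simp [mul_div_cancel₀ _ h]

theorem isOpenEmbedding_affineParam (i : Fin (m + 1)) : IsOpenEmbedding (affineParam i) := by
  refine .of_continuous_injective_isOpenMap ?_ ?_ ?_
  · have : Continuous fun z : Fin m → ℂ => (⟨i.insertNth (α := fun _ => ℂ) 1 z,
        insertNth_one_ne_zero i z⟩ : {v : Fin (m + 1) → ℂ // v ≠ 0}) := by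
      refine Continuous.subtype_mk ?_ _
      exact continuous_const.finInsertNth i continuous_id
    exact continuous_coinduced_rng.comp this
  · intro z z' h
    obtain ⟨-, h⟩ := affineParam_eq_mk.1 h
    simpa using h
  · intro W hW
    refine isOpen_coinduced.2 ?_
    have : (Projectivization.mk' ℂ) ⁻¹' (affineParam i '' W)
        = {v : {v : Fin (m + 1) → ℂ // v ≠ 0} | v.1 i ≠ 0} ∩
          (fun v => fun j => v.1 (i.succAbove j) / v.1 i) ⁻¹' W := by
      ext v
      constructor
      · rintro ⟨z, hz, h⟩
        obtain ⟨h1, rfl⟩ := affineParam_eq_mk.1 h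
        exact ⟨h1, hz⟩
      · rintro ⟨h1, h2⟩
        exact ⟨_, h2, affineParam_eq_mk.2 ⟨h1, rfl⟩⟩
    rw [this]
    have hc : ∀ k, Continuous fun v : {v : Fin (m + 1) → ℂ // v ≠ 0} => v.1 k := fun k =>
      (continuous_apply k).comp continuous_subtype_val
    have ho : IsOpen {v : {v : Fin (m + 1) → ℂ // v ≠ 0} | v.1 i ≠ 0} :=
      isOpen_ne_fun (hc i) continuous_const
    refine ContinuousOn.isOpen_inter_preimage ?_ ho hW
    refine continuousOn_pi.2 fun j => ContinuousOn.div (hc _).continuousOn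
      (hc _).continuousOn fun v hv => hv

theorem exists_affineParam (l : ℙ ℂ (Fin (m + 1) → ℂ)) : ∃ i z, affineParam i z = l := by
  induction l with
  | h v hv =>
    obtain ⟨i, hi⟩ := Function.ne_iff.1 hv
    exact ⟨i, _, affineParam_eq_mk.2 ⟨hi, rfl⟩⟩

end Proj

/-! ### Charts of the suspension -/

section Chart

variable {d m : ℕ} {B : Type*} [TopologicalSpace B]

/-- Two paths inside the inverse image of a convex set by a chart are homotopic. -/
theorem homotopic_of_convex {E : Type*} [NormedAddCommGroup E] [NormedSpace ℝ E]
    (e : OpenPartialHomeomorph B E) {C : Set E} (hC : Convex ℝ C) (hCe : C ⊆ e.target)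
    {x y : B} (p q : Path x y) (hp : ∀ t, p t ∈ e.source ∧ e (p t) ∈ C)
    (hq : ∀ t, q t ∈ e.source ∧ e (q t) ∈ C) : p.Homotopic q := by
  have hcp : Continuous fun t => e (p t) :=
    e.continuousOn.comp_continuous p.continuous fun t => (hp t).1
  have hcq : Continuous fun t => e (q t) :=
    e.continuousOn.comp_continuous q.continuous fun t => (hq t).1
  have hmem : ∀ a : unitInterval × unitInterval,
      (1 - (a.1 : ℝ)) • e (p a.2) + (a.1 : ℝ) • e (q a.2) ∈ C := fun a =>
    hC (hp a.2).2 (hq a.2).2 (by linarith [a.1.2.2]) a.1.2.1 (by ring)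
  refine ⟨{
    toFun := fun a => e.symm ((1 - (a.1 : ℝ)) • e (p a.2) + (a.1 : ℝ) • e (q a.2))
    continuous_toFun := ?_
    map_zero_left := ?_
    map_one_left := ?_
    prop' := ?_ }⟩
  · refine e.symm.continuousOn.comp_continuous ?_ fun a => hCe (hmem a)
    have h1 := hcp.comp (continuous_snd (X := unitInterval) (Y := unitInterval))
    have h2 := hcq.comp (continuous_snd (X := unitInterval) (Y := unitInterval))
    have h3 : Continuous fun a : unitInterval × unitInterval => (a.1 : ℝ) := by fun_prop
    exact ((continuous_const.sub h3).smul h1).add (h3.smul h2)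
  · intro t
    simp [e.left_inv (hp t).1]
  · intro t
    simp [e.left_inv (hq t).1]
  · intro s t ht
    have hpq : p t = q t := by
      rcases ht with rfl | ht
      · simp
      · rw [mem_singleton_iff.1 ht]; simp
    change e.symm ((1 - (s : ℝ)) • e (p t) + (s : ℝ) • e (q t)) = p t
    rw [← hpq, ← add_smul, sub_add_cancel, one_smul, e.left_inv (hp t).1]

variable [ChartedSpace (EuclideanSpace ℝ (Fin d)) B]

variable (d) in
theorem exists_chartRadius (x : B) : ∃ r : ℝ, 0 < r ∧
    Metric.ball (chartAt (EuclideanSpace ℝ (Fin d)) x x) r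
      ⊆ (chartAt (EuclideanSpace ℝ (Fin d)) x).target :=
  Metric.isOpen_iff.1 (chartAt (EuclideanSpace ℝ (Fin d)) x).open_target _
    (mem_chart_target _ x)

variable (d) in
/-- A ball inside the target of the preferred chart at `x`, centred at the image of `x`. -/
def chartBall (x : B) : Set (EuclideanSpace ℝ (Fin d)) :=
  Metric.ball (chartAt (EuclideanSpace ℝ (Fin d)) x x) (exists_chartRadius d x).choose

theorem isOpen_chartBall (x : B) : IsOpen (chartBall d x) := Metric.isOpen_ball

theorem convex_chartBall (x : B) : Convex ℝ (chartBall d x) := convex_ball _ _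

theorem center_mem_chartBall (x : B) :
    chartAt (EuclideanSpace ℝ (Fin d)) x x ∈ chartBall d x :=
  Metric.mem_ball_self (exists_chartRadius d x).choose_spec.1

theorem chartBall_subset (x : B) :
    chartBall d x ⊆ (chartAt (EuclideanSpace ℝ (Fin d)) x).target :=
  (exists_chartRadius d x).choose_spec.2

/-- The path which is a straight segment in the chart at `x`. -/
def chartSegment (x : B) {u v : EuclideanSpace ℝ (Fin d)} (hu : u ∈ chartBall d x)
    (hv : v ∈ chartBall d x) :
    Path ((chartAt (EuclideanSpace ℝ (Fin d)) x).symm u)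
      ((chartAt (EuclideanSpace ℝ (Fin d)) x).symm v) where
  toFun t := (chartAt (EuclideanSpace ℝ (Fin d)) x).symm (AffineMap.lineMap u v (t : ℝ))
  continuous_toFun := by
    refine (chartAt (EuclideanSpace ℝ (Fin d)) x).symm.continuousOn.comp_continuous ?_ fun t =>
      chartBall_subset x ((convex_chartBall x).lineMap_mem hu hv t.2)
    exact AffineMap.lineMap_continuous.comp continuous_subtype_val
  source' := by simp
  target' := by simp

variable {x₀ : B}

/-- The local inverse of the covering projection, over the chart ball at the end point of `b`, which
takes the value `b` at this end point. -/
def localLift (b : UniversalCover B x₀) (u : chartBall d b.pt) : UniversalCover B x₀ :=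
  ⟨(chartAt (EuclideanSpace ℝ (Fin d)) b.pt).symm u,
    b.cls.trans (.mk ((chartSegment b.pt (center_mem_chartBall b.pt) u.2).cast
      ((chartAt (EuclideanSpace ℝ (Fin d)) b.pt).left_inv (mem_chart_source _ b.pt)).symm rfl))⟩

theorem UniversalCover.mk_eq_of_homotopic {x y y' : B} (γ : Path.Homotopic.Quotient x₀ x)
    (p : Path x y) (q : Path x y') (h : y = y') (hpq : p.Homotopic (q.cast rfl h)) :
    (⟨y, γ.trans (.mk p)⟩ : UniversalCover B x₀) = ⟨y', γ.trans (.mk q)⟩ := by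
  subst h
  rw [Path.Homotopic.Quotient.eq.2 hpq]
  rfl

theorem chartSegment_mem (x : B) {u v : EuclideanSpace ℝ (Fin d)} (hu : u ∈ chartBall d x)
    (hv : v ∈ chartBall d x) {C : Set (EuclideanSpace ℝ (Fin d))} (hC : Convex ℝ C) (huC : u ∈ C)
    (hvC : v ∈ C) (t : unitInterval) :
    chartSegment x hu hv t ∈ (chartAt (EuclideanSpace ℝ (Fin d)) x).source ∧
      chartAt (EuclideanSpace ℝ (Fin d)) x (chartSegment x hu hv t) ∈ C := by
  have h := chartBall_subset x ((convex_chartBall x).lineMap_mem hu hv t.2)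
  refine ⟨(chartAt (EuclideanSpace ℝ (Fin d)) x).map_target h, ?_⟩
  change chartAt (EuclideanSpace ℝ (Fin d)) x ((chartAt (EuclideanSpace ℝ (Fin d)) x).symm _) ∈ C
  rw [(chartAt (EuclideanSpace ℝ (Fin d)) x).right_inv h]
  exact hC.lineMap_mem huC hvC t.2

theorem mem_nhd_localLift (b : UniversalCover B x₀) (u : chartBall d b.pt)
    {C : Set (EuclideanSpace ℝ (Fin d))} (hC : Convex ℝ C) (hCb : C ⊆ chartBall d b.pt)
    (hu : (u : EuclideanSpace ℝ (Fin d)) ∈ C) (c : UniversalCover B x₀) :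
    c ∈ UniversalCover.nhd ((chartAt (EuclideanSpace ℝ (Fin d)) b.pt).source ∩
        chartAt (EuclideanSpace ℝ (Fin d)) b.pt ⁻¹' C) (localLift b u) ↔
      ∃ v : chartBall d b.pt, (v : EuclideanSpace ℝ (Fin d)) ∈ C ∧ c = localLift b v := by
  have key : ∀ {y y' : B}
      (p : Path ((chartAt (EuclideanSpace ℝ (Fin d)) b.pt).symm u) y) (v : chartBall d b.pt)
      (h : y = (chartAt (EuclideanSpace ℝ (Fin d)) b.pt).symm v),
      (∀ t, p t ∈ (chartAt (EuclideanSpace ℝ (Fin d)) b.pt).source ∩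
        chartAt (EuclideanSpace ℝ (Fin d)) b.pt ⁻¹' C) →
      (⟨y, (localLift b u).cls.trans (.mk p)⟩ : UniversalCover B x₀) = localLift b v := by
    intro y y' p v h hp
    unfold localLift
    rw [Path.Homotopic.Quotient.trans_assoc, ← Path.Homotopic.Quotient.mk_trans]
    refine UniversalCover.mk_eq_of_homotopic _ _ _ h ?_
    refine homotopic_of_convex (chartAt (EuclideanSpace ℝ (Fin d)) b.pt)
      (convex_chartBall b.pt) (chartBall_subset b.pt) _ _ ?_ ?_
    · intro t
      have ht : ∀ z ∈ range (Path.trans ((chartSegment b.pt (center_mem_chartBall b.pt) u.2).cast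
          ((chartAt (EuclideanSpace ℝ (Fin d)) b.pt).left_inv
            (mem_chart_source _ b.pt)).symm rfl) p),
          z ∈ (chartAt (EuclideanSpace ℝ (Fin d)) b.pt).source ∧
            chartAt (EuclideanSpace ℝ (Fin d)) b.pt z ∈ chartBall d b.pt := by
        rw [Path.trans_range]
        rintro z (⟨s, rfl⟩ | ⟨s, rfl⟩)
        · exact chartSegment_mem b.pt (center_mem_chartBall b.pt) u.2 (convex_chartBall b.pt)
            (center_mem_chartBall b.pt) u.2 s
        · exact ⟨(hp s).1, hCb (hp s).2⟩
      exact ht _ ⟨t, rfl⟩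
    · intro t
      exact chartSegment_mem b.pt (center_mem_chartBall b.pt) v.2 (convex_chartBall b.pt)
        (center_mem_chartBall b.pt) v.2 t
  constructor
  · rintro ⟨δ, h1, h2⟩
    rcases c with ⟨y, γ⟩
    have hy := h1 1
    rw [δ.target] at hy
    refine ⟨⟨chartAt (EuclideanSpace ℝ (Fin d)) b.pt y, hCb hy.2⟩, hy.2, ?_⟩
    change γ = _ at h2
    rw [h2]
    exact key (y' := y) δ _ ((chartAt (EuclideanSpace ℝ (Fin d)) b.pt).left_inv hy.1).symm h1
  · rintro ⟨v, hv, rfl⟩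
    have hseg := chartSegment_mem b.pt u.2 v.2 hC hu hv
    refine ⟨chartSegment b.pt u.2 v.2, hseg, ?_⟩
    have := key (y' := x₀) (chartSegment b.pt u.2 v.2) v rfl hseg
    exact (eq_of_heq (UniversalCover.mk.inj this).2).symm

theorem isOpen_chart_preimage (x : B) {C : Set (EuclideanSpace ℝ (Fin d))} (hC : IsOpen C) :
    IsOpen ((chartAt (EuclideanSpace ℝ (Fin d)) x).source ∩
      chartAt (EuclideanSpace ℝ (Fin d)) x ⁻¹' C) :=
  (chartAt (EuclideanSpace ℝ (Fin d)) x).isOpen_inter_preimage hC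

theorem localLift_pt_mem (b : UniversalCover B x₀) (u : chartBall d b.pt)
    {C : Set (EuclideanSpace ℝ (Fin d))} (hu : (u : EuclideanSpace ℝ (Fin d)) ∈ C) :
    (localLift b u).pt ∈ (chartAt (EuclideanSpace ℝ (Fin d)) b.pt).source ∩
      chartAt (EuclideanSpace ℝ (Fin d)) b.pt ⁻¹' C := by
  have h := chartBall_subset b.pt u.2
  refine ⟨(chartAt (EuclideanSpace ℝ (Fin d)) b.pt).map_target h, ?_⟩
  change chartAt (EuclideanSpace ℝ (Fin d)) b.pt
    ((chartAt (EuclideanSpace ℝ (Fin d)) b.pt).symm _) ∈ C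
  rwa [(chartAt (EuclideanSpace ℝ (Fin d)) b.pt).right_inv h]

theorem localLift_pt_injective (b : UniversalCover B x₀) {u v : chartBall d b.pt}
    (h : (localLift b u).pt = (localLift b v).pt) : u = v :=
  Subtype.ext ((chartAt (EuclideanSpace ℝ (Fin d)) b.pt).symm.injOn
    (chartBall_subset b.pt u.2) (chartBall_subset b.pt v.2) h)

theorem isOpenEmbedding_localLift (b : UniversalCover B x₀) :
    IsOpenEmbedding (localLift (d := d) b) := by
  refine .of_continuous_injective_isOpenMap ?_
    (fun u v h => localLift_pt_injective b (congrArg UniversalCover.pt h)) ?_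
  · refine continuous_def.2 fun s hs => isOpen_iff_mem_nhds.2 fun u hu => ?_
    obtain ⟨V, hV, hbV, hVs⟩ := UniversalCover.isOpen_def.1 hs _ hu
    have hO : IsOpen (chartBall d b.pt ∩
        (chartAt (EuclideanSpace ℝ (Fin d)) b.pt).symm ⁻¹' V) := by
      have h1 := (chartAt (EuclideanSpace ℝ (Fin d)) b.pt).isOpen_inter_preimage_symm hV
      have h2 := (isOpen_chartBall (d := d) b.pt).inter h1
      rwa [← inter_assoc, inter_eq_left.2 (chartBall_subset b.pt)] at h2
    obtain ⟨r, hr, hrO⟩ := Metric.isOpen_iff.1 hO u.1 ⟨u.2, hbV⟩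
    have hsub : Metric.ball (u : EuclideanSpace ℝ (Fin d)) r ⊆ chartBall d b.pt :=
      fun v hv => (hrO hv).1
    refine mem_of_superset (continuous_subtype_val.continuousAt.preimage_mem_nhds
      (Metric.ball_mem_nhds u.1 hr)) fun v hv => hVs ?_
    refine UniversalCover.nhd_mono ?_ _ ((mem_nhd_localLift b u (convex_ball u.1 r) hsub
      (Metric.mem_ball_self hr) _).2 ⟨v, hv, rfl⟩)
    rintro y ⟨hy, hyr⟩
    have := (hrO hyr).2
    rwa [mem_preimage, (chartAt (EuclideanSpace ℝ (Fin d)) b.pt).left_inv hy] at this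
  · intro W hW
    refine UniversalCover.isOpen_def.2 ?_
    rintro _ ⟨u, hu, rfl⟩
    obtain ⟨O, hO, rfl⟩ := isOpen_induced_iff.1 hW
    obtain ⟨r, hr, hrO⟩ := Metric.isOpen_iff.1 ((isOpen_chartBall b.pt).inter hO) u.1 ⟨u.2, hu⟩
    refine ⟨_, isOpen_chart_preimage b.pt (C := Metric.ball u.1 r) Metric.isOpen_ball,
      localLift_pt_mem b u (Metric.mem_ball_self hr), fun c hc => ?_⟩
    obtain ⟨v, hv, rfl⟩ := (mem_nhd_localLift b u (convex_ball u.1 r) (fun v hv => (hrO hv).1)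
      (Metric.mem_ball_self hr) c).1 hc
    exact ⟨v, (hrO hv).2, rfl⟩

theorem localLift_center (b : UniversalCover B x₀) :
    localLift b ⟨_, center_mem_chartBall (d := d) b.pt⟩ = b := by
  rcases b with ⟨x, γ⟩
  have h := UniversalCover.mk_eq_of_homotopic γ
    ((chartSegment x (center_mem_chartBall x) (center_mem_chartBall (d := d) x)).cast
      ((chartAt (EuclideanSpace ℝ (Fin d)) x).left_inv (mem_chart_source _ x)).symm rfl)
    (Path.refl x) ((chartAt (EuclideanSpace ℝ (Fin d)) x).left_inv (mem_chart_source _ x)) ?_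
  · refine h.trans ?_
    rw [Path.Homotopic.Quotient.mk_refl, Path.Homotopic.Quotient.trans_refl]
  · refine homotopic_of_convex (chartAt (EuclideanSpace ℝ (Fin d)) x)
      (convex_chartBall x) (chartBall_subset x) _ _ ?_ ?_
    · exact chartSegment_mem x (center_mem_chartBall x) (center_mem_chartBall x)
        (convex_chartBall x) (center_mem_chartBall x) (center_mem_chartBall x)
    · exact fun t => ⟨mem_chart_source _ x, center_mem_chartBall x⟩

namespace Suspension

variable {Q : Type*} [Group Q] [MulAction Q (ℙ ℂ (Fin (m + 1) → ℂ))]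
  [ContinuousConstSMul Q (ℙ ℂ (Fin (m + 1) → ℂ))] (ρ : FundamentalGroup B x₀ →* Q)

/-- The local parametrisation of the suspension of an action on projective space given by a local
inverse of the covering projection and by affine coordinates. -/
def chartParam (b : UniversalCover B x₀) (i : Fin (m + 1))
    (p : chartBall d b.pt × (Fin m → ℂ)) : Suspension ρ (ℙ ℂ (Fin (m + 1) → ℂ)) :=
  mk ρ (localLift b p.1) (affineParam i p.2)

theorem isOpenEmbedding_chartParam (b : UniversalCover B x₀) (i : Fin (m + 1)) :
    IsOpenEmbedding (chartParam (d := d) ρ b i) := by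
  have h := (isOpenEmbedding_localLift (d := d) b).prodMap (isOpenEmbedding_affineParam i)
  refine .of_continuous_injective_isOpenMap (continuous_mk.comp h.continuous) ?_
    (isOpenMap_mk.comp h.isOpenMap)
  rintro ⟨u, z⟩ ⟨v, w⟩ huv
  obtain ⟨g, h1, h2⟩ := mk_eq_mk.1 huv
  change localLift b v = g • localLift b u at h1
  change affineParam i w = ρ g • affineParam i z at h2
  have h3 : (localLift b v).pt = (localLift b u).pt :=
    (congrArg UniversalCover.pt h1).trans (UniversalCover.smul_pt g _)
  obtain rfl : v = u := localLift_pt_injective b h3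
  obtain rfl : g = 1 := UniversalCover.eq_of_smul_eq h1.symm
  rw [map_one, one_smul] at h2
  rw [(isOpenEmbedding_affineParam i).injective h2]

/-- The chart inverse to `chartParam`. -/
def chart (b : UniversalCover B x₀) (i : Fin (m + 1)) :
    OpenPartialHomeomorph (Suspension ρ (ℙ ℂ (Fin (m + 1) → ℂ)))
      (EuclideanSpace ℝ (Fin d) × (Fin m → ℂ)) :=
  haveI : Nonempty (chartBall d b.pt) := ⟨⟨_, center_mem_chartBall b.pt⟩⟩
  ((isOpenEmbedding_chartParam ρ b i).toOpenPartialHomeomorph _).symm.trans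
    (((isOpen_chartBall b.pt).isOpenEmbedding_subtypeVal.toOpenPartialHomeomorph _).prod
      (OpenPartialHomeomorph.refl (Fin m → ℂ)))

theorem chart_source (b : UniversalCover B x₀) (i : Fin (m + 1)) :
    (chart (d := d) ρ b i).source = range (chartParam (d := d) ρ b i) := by
  simp [chart]

theorem exists_mem_chart_source (e : Suspension ρ (ℙ ℂ (Fin (m + 1) → ℂ))) :
    ∃ c : UniversalCover B x₀ × Fin (m + 1), e ∈ (chart (d := d) ρ c.1 c.2).source := by
  obtain ⟨b, l, rfl⟩ := exists_mk e
  obtain ⟨i, z, rfl⟩ := exists_affineParam l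
  refine ⟨(b, i), ?_⟩
  rw [chart_source]
  exact ⟨(⟨_, center_mem_chartBall b.pt⟩, z), by rw [chartParam, localLift_center]⟩

/-- The manifold structure of the projective suspension over a manifold of dimension `d`. -/
instance : ChartedSpace (EuclideanSpace ℝ (Fin d) × (Fin m → ℂ))
    (Suspension ρ (ℙ ℂ (Fin (m + 1) → ℂ))) where
  atlas := range fun c : UniversalCover B x₀ × Fin (m + 1) => chart ρ c.1 c.2
  chartAt e := chart ρ (exists_mem_chart_source ρ e).choose.1 (exists_mem_chart_source ρ e).choose.2
  mem_chart_source e := (exists_mem_chart_source ρ e).choose_spec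
  chart_mem_atlas _ := ⟨_, rfl⟩

end Suspension

end Chart

/-! ### The flat vector bundle and its projectivisation -/

section Bundle

variable {m : ℕ} {B : Type*} [TopologicalSpace B] {x₀ : B}

/-- The flat vector bundle with monodromy `ρ`. -/
abbrev FlatBundle (ρ : FundamentalGroup B x₀ →* GL (Fin (m + 1)) ℂ) : Type _ :=
  Suspension ρ (Fin (m + 1) → ℂ)

/-- The projectivisation of a linear representation. -/
abbrev projRep (ρ : FundamentalGroup B x₀ →* GL (Fin (m + 1)) ℂ) :
    FundamentalGroup B x₀ →* PGL(Fin (m + 1), ℂ) :=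
  Matrix.ProjGenLinGroup.mk.comp ρ

/-- The suspension of the projectivised representation, a bundle of projective spaces. -/
abbrev ProjBundle (ρ : FundamentalGroup B x₀ →* GL (Fin (m + 1)) ℂ) : Type _ :=
  Suspension (projRep ρ) (ℙ ℂ (Fin (m + 1) → ℂ))

variable {ρ : FundamentalGroup B x₀ →* GL (Fin (m + 1)) ℂ}

variable (ρ) in
/-- The fibre of the flat vector bundle at `x`. -/
def Fiber (x : B) : Type _ := {e : FlatBundle ρ // e.proj = x}

namespace Fiber

variable (ρ) in
/-- The identification of the typical fibre with the fibre at `x` given by a point of the universal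
cover above `x`. -/
def param {x : B} (b : UniversalCover B x₀) (hb : b.pt = x) : (Fin (m + 1) → ℂ) ≃ Fiber ρ x :=
  Equiv.ofBijective (fun w => ⟨Suspension.mk ρ b w, hb⟩) (by
    constructor
    · intro w w' h
      obtain ⟨g, h1, h2⟩ := Suspension.mk_eq_mk.1 (congrArg Subtype.val h)
      obtain rfl := UniversalCover.eq_of_smul_eq h1.symm
      rw [h2, map_one, one_smul]
    · rintro ⟨e, he⟩
      obtain ⟨c, w, rfl⟩ := Suspension.exists_mk e
      obtain ⟨g, rfl⟩ := UniversalCover.exists_smul_eq (b := c) (c := b) (hb.trans he.symm).symm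
      exact ⟨ρ g • w, Subtype.ext (Suspension.mk_eq_mk.2 ⟨g, rfl, rfl⟩).symm⟩)

theorem param_smul {x : B} (b : UniversalCover B x₀) (hb : b.pt = x) (g : FundamentalGroup B x₀)
    (w : Fin (m + 1) → ℂ) : param ρ (g • b) hb (ρ g • w) = param ρ b hb w :=
  Subtype.ext (Suspension.mk_eq_mk.2 ⟨g, rfl, rfl⟩).symm

/-- The lift of the flow, from the fibre at `x` to the fibre at `φ t x`. -/
def flow (φ : Flow ℝ B) (t : ℝ) {x : B} (e : Fiber ρ x) : Fiber ρ (φ t x) :=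
  ⟨Suspension.flow φ t e.1, by rw [Suspension.proj_flow, e.2]⟩

variable [PathConnectedSpace B]

variable (ρ) in
/-- A choice of one of the identifications `param`. -/
def baseParam (x : B) : (Fin (m + 1) → ℂ) ≃ Fiber ρ x :=
  param ρ (UniversalCover.exists_pt_eq (x₀ := x₀) x).choose
    (UniversalCover.exists_pt_eq (x₀ := x₀) x).choose_spec

/-- The vector space structure of the fibres is the one for which all `param` are linear, see
`linearParam`. -/
instance (x : B) : AddCommGroup (Fiber ρ x) := (baseParam ρ x).symm.addCommGroup

instance (x : B) : Module ℂ (Fiber ρ x) := (baseParam ρ x).symm.module ℂ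

variable (ρ) in
/-- The linear identification of the typical fibre with the fibre at `x` given by a point of the
universal cover above `x`. -/
def linearParam {x : B} (b : UniversalCover B x₀) (hb : b.pt = x) :
    (Fin (m + 1) → ℂ) ≃ₗ[ℂ] Fiber ρ x :=
  { param ρ b hb with
    map_add' := by
      obtain ⟨g, hg⟩ := UniversalCover.exists_smul_eq
        (hb.trans (UniversalCover.exists_pt_eq (x₀ := x₀) x).choose_spec.symm)
      have h : ∀ w, param ρ b hb w = baseParam ρ x (ρ g • w) := fun w => by
        rw [← param_smul b hb g]
        exact Subtype.ext (by simp only [baseParam, hg])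
      intro w w'
      change param ρ b hb (w + w') = baseParam ρ x ((baseParam ρ x).symm (param ρ b hb w)
        + (baseParam ρ x).symm (param ρ b hb w'))
      simp only [h, Equiv.symm_apply_apply, smul_add]
    map_smul' := by
      obtain ⟨g, hg⟩ := UniversalCover.exists_smul_eq
        (hb.trans (UniversalCover.exists_pt_eq (x₀ := x₀) x).choose_spec.symm)
      have h : ∀ w, param ρ b hb w = baseParam ρ x (ρ g • w) := fun w => by
        rw [← param_smul b hb g]
        exact Subtype.ext (by simp only [baseParam, hg])
      intro a w
      change param ρ b hb (a • w) = baseParam ρ x (a • (baseParam ρ x).symm (param ρ b hb w))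
      simp only [h, Equiv.symm_apply_apply]
      rw [smul_comm] }

end Fiber

/-- A continuous Hermitian metric on the fibres of the flat vector bundle, through its norm: a
continuous function on the total space which on each fibre is the norm of a positive definite
Hermitian form. -/
structure HermitianMetric (ρ : FundamentalGroup B x₀ →* GL (Fin (m + 1)) ℂ) where
  /-- the norm -/
  norm : FlatBundle ρ → ℝ
  continuous_norm : Continuous norm
  norm_nonneg : ∀ e, 0 ≤ norm e
  hermitian : ∀ b : UniversalCover B x₀, ∃ H : Matrix (Fin (m + 1)) (Fin (m + 1)) ℂ, H.PosDef ∧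
    ∀ w, norm (Suspension.mk ρ b w) ^ 2 = (star w ⬝ᵥ H.mulVec w).re

variable [PathConnectedSpace B] [MeasurableSpace B]

/-- Over `A`, the family of subspaces `F` has a measurable frame with `k` elements. -/
def IsMeasurableSubbundle (k : ℕ) (A : Set B) (F : ∀ x, Submodule ℂ (Fiber ρ x)) : Prop :=
  ∃ s : Fin k → ∀ x, Fiber ρ x, (∀ i, Measurable fun x : A => (s i x).1) ∧
    ∀ x ∈ A, LinearIndependent ℂ (fun i => s i x) ∧ Submodule.span ℂ (range fun i => s i x) = F x

/-- The splitting `F ⊕ G` over `A` exhibits a section of largest expansion. -/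
structure IsLargestExpansionSplitting (H : Type*) [TopologicalSpace H] [MeasureSpace H]
    [ChartedSpace H B] (φ : Flow ℝ B) (N : HermitianMetric ρ) (A : Set B)
    (F G : ∀ x, Submodule ℂ (Fiber ρ x)) : Prop where
  total : LebesgueNull H Aᶜ
  invariant : ∀ t, ∀ x ∈ A, φ t x ∈ A
  isCompl : ∀ x ∈ A, IsCompl (F x) (G x)
  finrank_eq_one : ∀ x ∈ A, Module.finrank ℂ (F x) = 1
  measurable_fst : IsMeasurableSubbundle 1 A F
  measurable_snd : IsMeasurableSubbundle m A G
  flow_fst : ∀ t, ∀ x ∈ A, (F (φ t x) : Set (Fiber ρ (φ t x))) = Fiber.flow φ t '' F x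
  flow_snd : ∀ t, ∀ x ∈ A, (G (φ t x) : Set (Fiber ρ (φ t x))) = Fiber.flow φ t '' G x
  expansion : ∀ x ∈ A, ∀ K : Set B, IsCompact K → ∀ t : ℕ → ℝ, Tendsto t atTop atTop →
    (∀ n, φ (t n) x ∈ K) → ∀ w₁ ∈ F x, w₁ ≠ 0 → ∀ w₂ ∈ G x, w₂ ≠ 0 →
    Tendsto (fun n => N.norm (Fiber.flow φ (t n) w₁).1 / N.norm (Fiber.flow φ (t n) w₂).1)
      atTop atTop

/-- `σ` is a section of largest expansion: over a set `A` as above it is the point of the projective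
bundle given by the line `F x`. The values of `σ` outside `A`, a null set, are immaterial. -/
def IsSectionOfLargestExpansion (H : Type*) [TopologicalSpace H] [MeasureSpace H]
    [ChartedSpace H B] (φ : Flow ℝ B) (N : HermitianMetric ρ) (σ : B → ProjBundle ρ) : Prop :=
  ∃ (A : Set B) (F G : ∀ x, Submodule ℂ (Fiber ρ x)), IsLargestExpansionSplitting H φ N A F G ∧
    ∀ x ∈ A, ∀ (b : UniversalCover B x₀) (hb : b.pt = x) (w : Fin (m + 1) → ℂ) (hw : w ≠ 0),
      Fiber.linearParam ρ b hb w ∈ F x → σ x = Suspension.mk (projRep ρ) b (.mk ℂ w hw)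

end Bundle

end

/-! The line field F is invariant, so σ⁺ intertwines φ and Φ almost everywhere and carries λ to a
Φ-invariant measure. The pointwise ergodic theorem, transported by σ⁺, puts σ⁺(x) in the basin of
σ⁺_*λ for λ-almost every x (`ae_tendsto_timeAverage_section`).

The basin then absorbs almost all of the fibre over such an x. Let w = w₁ + w₂ with w₁ ∈ F_x
non-zero and w₂ ∈ G_x. At the times when φ_t(x) visits a given compact set, the image of w₂ is
negligible against that of w₁, so the lines of the images of w and w₁ get close. A compactly
supported h sees no other times: it vanishes at both points when the base point is outside the
projection of its support. Hence the values of h along the two orbits are asymptotic and the time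
averages agree (`tendsto_sub_of_expansion`, `IsLargestExpansionSplitting.mem_basin`). Compactness of
B is not needed.

What is left in the fibre is Proj(G_x), a hyperplane, hence null. Fubini in the charts of M_ρ, with
the measurable frame of G, makes the complement of the basin null
(`volume_setOf_insertNth_mem_span`, `IsLargestExpansionSplitting.lebesgueNull_compl`). Positivity of
the density allows passing between λ-null and Lebesgue-null sets of B.

The ergodic theorem itself comes from the maximal inequality for the time-one map. A single
exceptional null set serves all h because weak convergence can be tested on countably many open sets
(`ae_forall_tendsto_timeAverage`). -/

/-! ### The pointwise ergodic theorem for flows -/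

section Ergodic

/-! ### The maximal ergodic theorem. -/

section MaximalErgodic

variable {α : Type*} {T : α → α} {f : α → ℝ}

/-- The maximum of the Birkhoff sums of order at most `n`. -/
def maxBirkhoffSum (T : α → α) (f : α → ℝ) : ℕ → α → ℝ
  | 0 => fun _ => 0
  | n + 1 => fun x => max 0 (f x + maxBirkhoffSum T f n (T x))

theorem maxBirkhoffSum_nonneg (n : ℕ) (x : α) : 0 ≤ maxBirkhoffSum T f n x := by
  cases n with
  | zero => exact le_rfl
  | succ n => exact le_max_left _ _

theorem maxBirkhoffSum_le_succ (n : ℕ) (x : α) :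
    maxBirkhoffSum T f n x ≤ maxBirkhoffSum T f (n + 1) x := by
  induction n generalizing x with
  | zero => exact maxBirkhoffSum_nonneg _ _
  | succ n ih => exact max_le_max le_rfl (by linarith [ih (T x)])

theorem birkhoffSum_le_maxBirkhoffSum (n : ℕ) (x : α) :
    birkhoffSum T f n x ≤ maxBirkhoffSum T f n x := by
  induction n generalizing x with
  | zero => simp [maxBirkhoffSum]
  | succ n ih =>
    rw [birkhoffSum_succ']
    exact le_max_of_le_right (by linarith [ih (T x)])

variable [MeasurableSpace α] {μ : Measure α}

theorem measurable_maxBirkhoffSum (hT : Measurable T) (hf : Measurable f) (n : ℕ) :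
    Measurable (maxBirkhoffSum T f n) := by
  induction n with
  | zero => exact measurable_const
  | succ n ih => exact measurable_const.max (hf.add (ih.comp hT))

theorem integrable_maxBirkhoffSum (hT : MeasurePreserving T μ μ) (hf : Integrable f μ) (n : ℕ) :
    Integrable (maxBirkhoffSum T f n) μ := by
  induction n with
  | zero => exact integrable_zero _ _ _
  | succ n ih => exact (integrable_zero _ _ _).sup (hf.add (hT.integrable_comp_of_integrable ih))

/-- The maximal ergodic theorem. -/
theorem setIntegral_maxBirkhoffSum_pos_nonneg (hT : MeasurePreserving T μ μ) (hfm : Measurable f)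
    (hf : Integrable f μ) (n : ℕ) : 0 ≤ ∫ x in {x | 0 < maxBirkhoffSum T f n x}, f x ∂μ := by
  have hm : MeasurableSet {x | 0 < maxBirkhoffSum T f n x} :=
    measurableSet_lt measurable_const (measurable_maxBirkhoffSum hT.measurable hfm n)
  have hi := integrable_maxBirkhoffSum hT hf n
  have hiT : Integrable (fun x => maxBirkhoffSum T f n (T x)) μ :=
    hT.integrable_comp_of_integrable hi
  -- Garsia's argument: where the maximum M_n is positive it is not attained by the empty sum, so
  -- M_n ≤ f + M_n ∘ T there.
  have h1 : ∫ x in {x | 0 < maxBirkhoffSum T f n x},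
      (maxBirkhoffSum T f n x - maxBirkhoffSum T f n (T x)) ∂μ
        ≤ ∫ x in {x | 0 < maxBirkhoffSum T f n x}, f x ∂μ := by
    refine setIntegral_mono_on (hi.sub hiT).integrableOn hf.integrableOn hm fun x hx => ?_
    cases n with
    | zero => exact absurd (show (0 : ℝ) < 0 from hx) (lt_irrefl _)
    | succ n =>
      have h2 : maxBirkhoffSum T f (n + 1) x = f x + maxBirkhoffSum T f n (T x) :=
        max_eq_right (lt_max_iff.1 hx |>.resolve_left (lt_irrefl _)).le
      linarith [maxBirkhoffSum_le_succ (T := T) (f := f) n (T x)]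
  refine le_trans ?_ h1
  rw [integral_sub hi.integrableOn hiT.integrableOn]
  have h3 : ∫ x in {x | 0 < maxBirkhoffSum T f n x}, maxBirkhoffSum T f n x ∂μ
      = ∫ x, maxBirkhoffSum T f n x ∂μ := by
    refine setIntegral_eq_integral_of_forall_compl_eq_zero fun x hx => ?_
    exact le_antisymm (not_lt.1 hx) (maxBirkhoffSum_nonneg _ _)
  -- Dropping the restriction only increases the integral of M_n ∘ T ≥ 0, while M_n loses nothing
  -- because it vanishes off the set.
  have h4 : ∫ x in {x | 0 < maxBirkhoffSum T f n x}, maxBirkhoffSum T f n (T x) ∂μ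
      ≤ ∫ x, maxBirkhoffSum T f n (T x) ∂μ :=
    setIntegral_le_integral hiT (ae_of_all _ fun x => maxBirkhoffSum_nonneg _ _)
  have h5 : ∫ x, maxBirkhoffSum T f n (T x) ∂μ = ∫ x, maxBirkhoffSum T f n x ∂μ := by
    rw [← integral_map hT.measurable.aemeasurable
      (by rw [hT.map_eq]; exact hi.aestronglyMeasurable), hT.map_eq]
  linarith

/-- The sets {M_n > 0} increase to a set of full measure, so the maximal inequality passes to the
limit. -/
theorem integral_nonneg_of_birkhoffSum_pos (hT : MeasurePreserving T μ μ) (hfm : Measurable f)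
    (hf : Integrable f μ) (h : ∀ᵐ x ∂μ, ∃ n, 0 < birkhoffSum T f n x) : 0 ≤ ∫ x, f x ∂μ := by
  have hlim := tendsto_setIntegral_of_monotone (μ := μ) (f := f)
    (s := fun n => {x | 0 < maxBirkhoffSum T f n x})
    (fun n => measurableSet_lt measurable_const (measurable_maxBirkhoffSum hT.measurable hfm n))
    (monotone_nat_of_le_succ fun n x hx => lt_of_lt_of_le hx (maxBirkhoffSum_le_succ n x))
    hf.integrableOn
  have hU : (⋃ n, {x | 0 < maxBirkhoffSum T f n x}) =ᵐ[μ] univ := by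
    refine eventuallyEq_univ.2 ?_
    filter_upwards [h] with x ⟨n, hn⟩
    exact mem_iUnion.2 ⟨n, hn.trans_le (birkhoffSum_le_maxBirkhoffSum n x)⟩
  rw [setIntegral_congr_set hU, setIntegral_univ] at hlim
  exact ge_of_tendsto' hlim fun n => setIntegral_maxBirkhoffSum_pos_nonneg hT hfm hf n

end MaximalErgodic

variable {B : Type*} [TopologicalSpace B] [MeasurableSpace B] [BorelSpace B] {φ : Flow ℝ B} {μ : Measure B} {f : B → ℝ} {C : ℝ}

theorem measurable_flow_uncurry [SecondCountableTopology B] (φ : Flow ℝ B) : Measurable fun p : B × ℝ => φ p.2 p.1 := by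
  have : Continuous fun p : B × ℝ => φ p.2 p.1 := by fun_prop
  exact this.measurable

theorem measurable_flow_orbit (φ : Flow ℝ B) (x : B) : Measurable fun t : ℝ => φ t x := by
  have : Continuous fun t : ℝ => φ t x := by fun_prop
  exact this.measurable

theorem intervalIntegrable_of_measurable_of_le {g : ℝ → ℝ} (hg : Measurable g)
    (hC : ∀ t, |g t| ≤ C) (a b : ℝ) : IntervalIntegrable g volume a b :=
  (intervalIntegrable_const (c := C)).mono_fun hg.aestronglyMeasurable
    (ae_of_all _ fun t => by
      simpa [Real.norm_eq_abs] using (hC t).trans (le_abs_self C))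

/-- Bridge from the flow to the discrete maximal inequality. The time-one map preserves μ but need
not be ergodic, so ergodicity is applied only to sets invariant under the whole flow. -/
theorem birkhoffSum_intervalIntegral (hf : Measurable f) (hC : ∀ x, |f x| ≤ C) (n : ℕ) (x : B) :
    birkhoffSum (φ 1) (fun x => ∫ t in (0 : ℝ)..1, f (φ t x)) n x
      = ∫ t in (0 : ℝ)..n, f (φ t x) := by
  have hint : ∀ a b, IntervalIntegrable (fun t => f (φ t x)) volume a b :=
    intervalIntegrable_of_measurable_of_le (hf.comp (measurable_flow_orbit φ x)) fun t => hC _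
  induction n with
  | zero => simp
  | succ n ih =>
    have hit : ∀ k : ℕ, (φ 1)^[k] x = φ k x := by
      intro k
      induction k with
      | zero => simp
      | succ k ih => rw [Function.iterate_succ_apply', ih, ← φ.map_add, add_comm]; simp
    rw [birkhoffSum_succ, ih, hit]
    have : ∫ t in (0 : ℝ)..1, f (φ t (φ n x)) = ∫ t in (n : ℝ)..(n + 1 : ℕ), f (φ t x) := by
      have h2 := intervalIntegral.integral_comp_add_right (a := 0) (b := 1)
        (fun t => f (φ t x)) (n : ℝ)
      simp only [φ.map_add, zero_add] at h2
      rw [h2]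
      push_cast
      rw [add_comm]
    rw [this, intervalIntegral.integral_add_adjacent_intervals (hint _ _) (hint _ _)]

/-- The two windows of time differ by two intervals of length |s|. The bound is independent of T, so
it disappears in the averages, whose upper limit is therefore flow invariant. -/
theorem abs_intervalIntegral_flow_sub_le (hf : Measurable f) (hC : ∀ x, |f x| ≤ C) (s T : ℝ)
    (x : B) :
    |(∫ t in (0 : ℝ)..T, f (φ t (φ s x))) - ∫ t in (0 : ℝ)..T, f (φ t x)| ≤ 2 * (C * |s|) := by
  have hint : ∀ a b, IntervalIntegrable (fun t => f (φ t x)) volume a b :=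
    intervalIntegrable_of_measurable_of_le (hf.comp (measurable_flow_orbit φ x)) fun t => hC _
  have h2 := intervalIntegral.integral_comp_add_right (a := 0) (b := T) (fun t => f (φ t x)) s
  simp only [φ.map_add, zero_add] at h2
  rw [h2]
  have h3 : (∫ t in s..(T + s), f (φ t x)) - ∫ t in (0 : ℝ)..T, f (φ t x)
      = (∫ t in T..(T + s), f (φ t x)) - ∫ t in (0 : ℝ)..s, f (φ t x) := by
    rw [← intervalIntegral.integral_add_adjacent_intervals (hint 0 s) (hint s T),
      ← intervalIntegral.integral_add_adjacent_intervals (hint s T) (hint T (T + s))]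
    ring
  have h4 : ∀ a b, |∫ t in a..b, f (φ t x)| ≤ C * |b - a| := fun a b => by
    rw [← Real.norm_eq_abs]
    exact intervalIntegral.norm_integral_le_of_norm_le_const fun t _ => hC _
  rw [h3]
  have h5 := h4 T (T + s)
  have h6 := h4 0 s
  rw [add_sub_cancel_left] at h5
  rw [sub_zero] at h6
  exact (abs_sub _ _).trans (by linarith)

variable [SecondCountableTopology B]

theorem measurable_intervalIntegral_orbit (hf : Measurable f) {a b : ℝ} (hab : a ≤ b) :
    Measurable fun x => ∫ t in a..b, f (φ t x) := by
  simp only [intervalIntegral.integral_of_le hab]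
  have h : StronglyMeasurable fun p : B × ℝ => f (φ p.2 p.1) :=
    (hf.comp (measurable_flow_uncurry φ)).stronglyMeasurable
  exact (h.integral_prod_right (ν := volume.restrict (Ioc a b))).measurable

theorem integral_intervalIntegral_orbit [IsProbabilityMeasure μ]
    (hφ : ∀ t, MeasurePreserving (φ t) μ μ) (hf : Measurable f) (hC : ∀ x, |f x| ≤ C) :
    ∫ x, (∫ t in (0 : ℝ)..1, f (φ t x)) ∂μ = ∫ x, f x ∂μ := by
  simp only [intervalIntegral.integral_of_le zero_le_one]
  have hmeas : Measurable fun p : B × ℝ => f (φ p.2 p.1) := hf.comp (measurable_flow_uncurry φ)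
  rw [integral_integral_swap]
  · have : ∀ t, ∫ x, f (φ t x) ∂μ = ∫ x, f x ∂μ := fun t => by
      rw [← integral_map (hφ t).measurable.aemeasurable hf.aestronglyMeasurable, (hφ t).map_eq]
    simp [this]
  · exact Integrable.of_bound (f := Function.uncurry fun x t => f (φ t x))
      hmeas.aestronglyMeasurable C (ae_of_all _ fun p => hC _)

/-- For an ergodic flow the upper limit of the time averages is at most the space average. -/
theorem ae_eventually_timeAverage_le [IsProbabilityMeasure μ] (hφ : IsErgodicInvariant φ μ)
    (hf : Measurable f) (hC : ∀ x, |f x| ≤ C) {a : ℝ} (ha : ∫ x, f x ∂μ < a) :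
    ∀ᵐ x ∂μ, ∀ k : ℕ, ∀ᶠ n : ℕ in atTop,
      ∫ t in (0 : ℝ)..n, f (φ t x) ≤ n * (a + 1 / (k + 1)) := by
  set S : ℕ → B → ℝ := fun n x => ∫ t in (0 : ℝ)..n, f (φ t x) with hS
  have hSm : ∀ n, Measurable (S n) := fun n => measurable_intervalIntegral_orbit hf n.cast_nonneg
  -- The set where the upper limit of the averages exceeds a. The margin 1/(k+1) keeps it stable
  -- under bounded changes of S n.
  set E : Set B := {x | ∃ k : ℕ, ∃ᶠ n : ℕ in atTop, n * (a + 1 / (k + 1 : ℝ)) < S n x} with hE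
  have hEm : MeasurableSet E := by
    have : E = ⋃ k : ℕ, ⋂ N : ℕ, ⋃ n : ℕ, ⋃ _ : N ≤ n,
        {x | n * (a + 1 / (k + 1 : ℝ)) < S n x} := by
      ext x
      simp [hE, frequently_atTop]
    rw [this]
    exact .iUnion fun k => .iInter fun N => .iUnion fun n => .iUnion fun _ =>
      measurableSet_lt measurable_const (hSm n)
  have hsub : ∀ s, E ⊆ φ s ⁻¹' E := by
    rintro s x ⟨k, hk⟩
    -- Lowering the margin from 1/(k+1) to 1/(k+2) gains a multiple of n, which eventually beats the
    -- bounded error 2C|s|.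
    refine ⟨k + 1, ?_⟩
    have hpos : (0 : ℝ) < 1 / (k + 1) - 1 / (k + 1 + 1) := by
      rw [sub_pos]
      exact one_div_lt_one_div_of_lt (by positivity) (by linarith)
    have hev : ∀ᶠ n : ℕ in atTop,
        2 * (C * |s|) ≤ n * ((1 : ℝ) / (k + 1) - 1 / (k + 1 + 1)) :=
      (tendsto_natCast_atTop_atTop.atTop_mul_const hpos).eventually_ge_atTop _
    refine (hk.and_eventually hev).mono fun n hn => ?_
    have := abs_le.1 (abs_intervalIntegral_flow_sub_le (φ := φ) hf hC s n x)
    push_cast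
    have h1 := hn.1
    have h2 := hn.2
    simp only [hS] at h1 ⊢
    nlinarith [this.1]
  have hinv : ∀ s, φ s ⁻¹' E = E := by
    refine fun s => Subset.antisymm (fun x hx => ?_) (hsub s)
    have := hsub (-s) hx
    rwa [mem_preimage, ← φ.map_add, neg_add_cancel, φ.map_zero_apply] at this
  have h0 : μ E = 0 := by
    -- If E had full measure, almost every point would have a positive Birkhoff sum of the unit-time
    -- integral of f minus a, and the maximal inequality would give ∫ f ≥ a.
    refine (hφ.ergodic E hEm hinv).resolve_right fun h => ?_
    have hF : Measurable fun x => (∫ t in (0 : ℝ)..1, f (φ t x)) - a :=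
      (measurable_intervalIntegral_orbit hf zero_le_one).sub_const a
    have hb : ∀ x, |∫ t in (0 : ℝ)..1, f (φ t x)| ≤ C := fun x => by
      simpa using intervalIntegral.norm_integral_le_of_norm_le_const (a := 0) (b := 1)
        (f := fun t => f (φ t x)) fun t _ => hC _
    have hi : Integrable (fun x => ∫ t in (0 : ℝ)..1, f (φ t x)) μ :=
      Integrable.of_bound (measurable_intervalIntegral_orbit hf zero_le_one).aestronglyMeasurable C
        (ae_of_all _ hb)
    have key := integral_nonneg_of_birkhoffSum_pos (hφ.invariant 1) hF
      (hi.sub (integrable_const a)) (by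
        have h' : ∀ᵐ x ∂μ, x ∈ E := by rwa [ae_iff]
        filter_upwards [h'] with x ⟨k, hk⟩
        obtain ⟨n, hn⟩ := hk.exists
        refine ⟨n, ?_⟩
        have : birkhoffSum (φ 1) (fun x => (∫ t in (0 : ℝ)..1, f (φ t x)) - a) n x
            = S n x - n * a := by
          have h1 := birkhoffSum_intervalIntegral (φ := φ) hf hC n x
          simp only [hS]
          rw [← h1]
          simp [birkhoffSum, Finset.sum_sub_distrib]
        rw [this]
        have : (0 : ℝ) ≤ n * (1 / (k + 1)) := by positivity
        linarith)
    rw [integral_sub hi (integrable_const a), integral_intervalIntegral_orbit hφ.invariant hf hC]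
      at key
    simp at key
    linarith
  filter_upwards [measure_eq_zero_iff_ae_notMem.1 h0] with x hx k
  by_contra hk
  exact hx ⟨k, (not_eventually.1 hk).mono fun n hn => not_le.1 hn⟩

/-- The pointwise ergodic theorem for an ergodic flow and a bounded function. -/
theorem ae_tendsto_timeAverage [IsProbabilityMeasure μ] (hφ : IsErgodicInvariant φ μ)
    (hf : Measurable f) (hC : ∀ x, |f x| ≤ C) :
    ∀ᵐ x ∂μ, Tendsto (fun n : ℕ => (n : ℝ)⁻¹ * ∫ t in (0 : ℝ)..n, f (φ t x)) atTop
      (𝓝 (∫ x, f x ∂μ)) := by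
  -- Applied to f and to -f, this bounds the averages on both sides. Of the error 2/(j+1), one half
  -- separates a from ∫ g and the other is the margin with k = j.
  have upper : ∀ g : B → ℝ, Measurable g → (∀ x, |g x| ≤ C) → ∀ᵐ x ∂μ, ∀ j : ℕ,
      ∀ᶠ n : ℕ in atTop, (n : ℝ)⁻¹ * ∫ t in (0 : ℝ)..n, g (φ t x)
        ≤ (∫ x, g x ∂μ) + 2 / (j + 1) := by
    intro g hg hgC
    rw [ae_all_iff]
    intro j
    have hj : (0 : ℝ) < 1 / (j + 1) := by positivity
    filter_upwards [ae_eventually_timeAverage_le hφ hg hgC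
      (a := (∫ x, g x ∂μ) + 1 / (j + 1)) (by linarith)] with x hx
    filter_upwards [hx j, eventually_gt_atTop 0] with n hn h0
    have h0' : (0 : ℝ) < n := by exact_mod_cast h0
    rw [inv_mul_le_iff₀ h0']
    refine hn.trans (le_of_eq ?_)
    ring
  have hlim : Tendsto (fun j : ℕ => 2 / ((j : ℝ) + 1)) atTop (𝓝 0) := by
    have := (tendsto_one_div_add_atTop_nhds_zero_nat (𝕜 := ℝ)).const_mul 2
    simpa [div_eq_mul_inv] using this
  filter_upwards [upper f hf hC, upper (fun x => -f x) hf.neg (by simpa using hC)] with x h1 h2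
  rw [Metric.tendsto_atTop']
  intro ε hε
  obtain ⟨j, hj⟩ := (hlim.eventually (gt_mem_nhds hε)).exists
  obtain ⟨N, hN⟩ := eventually_atTop.1 ((h1 j).and (h2 j))
  refine ⟨N, fun n hn => ?_⟩
  obtain ⟨h3, h4⟩ := hN n hn.le
  rw [intervalIntegral.integral_neg, integral_neg, mul_neg] at h4
  rw [Real.dist_eq, abs_lt]
  constructor <;> linarith

end Ergodic

/-! ### Time averages of continuous functions -/

section TimeAverage

theorem tendsto_timeAverage_zero {g : ℝ → ℝ} {C : ℝ} (hg : Measurable g) (hC : ∀ t, |g t| ≤ C)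
    (h : Tendsto g atTop (𝓝 0)) :
    Tendsto (fun T : ℝ => (1 / T) * ∫ t in (0 : ℝ)..T, g t) atTop (𝓝 0) := by
  have hint := intervalIntegrable_of_measurable_of_le hg hC
  rw [Metric.tendsto_atTop]
  intro ε hε
  obtain ⟨S, hS⟩ := eventually_atTop.1 ((Metric.tendsto_nhds.1 h) (ε / 2) (half_pos hε))
  have h1 : Tendsto (fun T : ℝ => ε / 2 * T) atTop atTop :=
    tendsto_id.const_mul_atTop (half_pos hε)
  -- Past S the integrand is below ε/2; T is taken large enough to dominate the fixed initial
  -- integral. The term in |S| covers T - S when S is negative.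
  have hpos : ∀ᶠ T : ℝ in atTop, S ≤ T ∧ 0 < T ∧
      |∫ t in (0 : ℝ)..S, g t| + ε / 2 * |S| < ε / 2 * T :=
    (eventually_ge_atTop S).and ((eventually_gt_atTop 0).and (h1.eventually_gt_atTop _))
  obtain ⟨R, hR⟩ := eventually_atTop.1 hpos
  refine ⟨R, fun T hT => ?_⟩
  obtain ⟨hST, hT0, hTS⟩ := hR T hT
  have h2 : |∫ t in S..T, g t| ≤ ε / 2 * |T - S| := by
    rw [← Real.norm_eq_abs]
    refine intervalIntegral.norm_integral_le_of_norm_le_const fun t ht => ?_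
    rw [uIoc_of_le hST] at ht
    simpa [Real.dist_eq] using (hS t ht.1.le).le
  have h3 : |∫ t in (0 : ℝ)..T, g t| < ε * T := by
    rw [← intervalIntegral.integral_add_adjacent_intervals (hint 0 S) (hint S T)]
    refine (abs_add_le _ _).trans_lt ?_
    rw [abs_of_nonneg (sub_nonneg.2 hST)] at h2
    nlinarith [neg_abs_le S]
  rw [dist_zero_right, norm_mul, Real.norm_eq_abs, Real.norm_eq_abs, abs_of_pos (by positivity),
    one_div, inv_mul_lt_iff₀ hT0]
  linarith

/-- Since ⌊T⌋/T → 1, only the piece of orbit between ⌊T⌋ and T matters; its length is at most 1, so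
it contributes O(1/T). -/
theorem tendsto_timeAverage_of_nat {g : ℝ → ℝ} {C L : ℝ} (hg : Measurable g)
    (hC : ∀ t, |g t| ≤ C)
    (h : Tendsto (fun n : ℕ => (n : ℝ)⁻¹ * ∫ t in (0 : ℝ)..n, g t) atTop (𝓝 L)) :
    Tendsto (fun T : ℝ => (1 / T) * ∫ t in (0 : ℝ)..T, g t) atTop (𝓝 L) := by
  have hint := intervalIntegrable_of_measurable_of_le hg hC
  have h1 : Tendsto (fun T : ℝ => ((⌊T⌋₊ : ℝ) / T) *
      ((⌊T⌋₊ : ℝ)⁻¹ * ∫ t in (0 : ℝ)..⌊T⌋₊, g t)) atTop (𝓝 (1 * L)) :=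
    tendsto_nat_floor_div_atTop.mul (h.comp tendsto_nat_floor_atTop)
  have h2 : Tendsto (fun T : ℝ => (1 / T) * ∫ t in (⌊T⌋₊ : ℝ)..T, g t) atTop (𝓝 0) := by
    refine squeeze_zero_norm' (a := fun T : ℝ => |C| / T) ?_
      (tendsto_const_nhds.div_atTop tendsto_id)
    filter_upwards [eventually_gt_atTop 0] with T hT
    have h3 : ‖∫ t in (⌊T⌋₊ : ℝ)..T, g t‖ ≤ |C| * |T - ⌊T⌋₊| :=
      intervalIntegral.norm_integral_le_of_norm_le_const fun t _ => (hC t).trans (le_abs_self C)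
    have h4 : |T - ⌊T⌋₊| ≤ 1 := by
      rw [abs_of_nonneg (sub_nonneg.2 (Nat.floor_le hT.le))]
      linarith [Nat.lt_floor_add_one T]
    rw [norm_mul, Real.norm_eq_abs, abs_of_pos (by positivity), one_div, div_eq_inv_mul]
    refine mul_le_mul_of_nonneg_left (h3.trans ?_) (by positivity)
    exact mul_le_of_le_one_right (abs_nonneg C) h4
  have h5 := h1.add h2
  rw [one_mul, add_zero] at h5
  refine h5.congr' ?_
  filter_upwards [eventually_ge_atTop 1] with T hT
  have h6 : (⌊T⌋₊ : ℝ) ≠ 0 := by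
    exact_mod_cast (Nat.floor_pos.2 hT).ne'
  rw [← intervalIntegral.integral_add_adjacent_intervals (hint 0 ⌊T⌋₊) (hint ⌊T⌋₊ T)]
  field_simp

theorem tendsto_timeAverage_of_sub_tendsto_zero {g k : ℝ → ℝ} {C L : ℝ} (hg : Measurable g)
    (hk : Measurable k) (hgC : ∀ t, |g t| ≤ C) (hkC : ∀ t, |k t| ≤ C)
    (hgk : Tendsto (fun t => k t - g t) atTop (𝓝 0))
    (h : Tendsto (fun T : ℝ => (1 / T) * ∫ t in (0 : ℝ)..T, g t) atTop (𝓝 L)) :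
    Tendsto (fun T : ℝ => (1 / T) * ∫ t in (0 : ℝ)..T, k t) atTop (𝓝 L) := by
  have h1 := tendsto_timeAverage_zero (hk.sub hg) (C := C + C)
    (fun t => (abs_sub _ _).trans (add_le_add (hkC t) (hgC t))) hgk
  have h2 := h.add h1
  rw [add_zero] at h2
  refine h2.congr fun T => ?_
  have := intervalIntegral.integral_sub (intervalIntegrable_of_measurable_of_le hk hkC 0 T)
    (intervalIntegrable_of_measurable_of_le hg hgC 0 T)
  simp only [Pi.sub_apply, this]
  ring

variable {B : Type*} [TopologicalSpace B] [MeasurableSpace B] [BorelSpace B] {φ : Flow ℝ B}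
  {M : Type*} [MeasurableSpace M] {τ : B → M}

/-- The distribution of `τ` along the orbit of `x` up to time `n + 1`. -/
noncomputable def empiricalMeasure (φ : Flow ℝ B) (τ : B → M) (x : B) (n : ℕ) : Measure M :=
  ((n + 1 : ENNReal)⁻¹ • volume.restrict (Ioc (0 : ℝ) (n + 1 : ℕ))).map fun t => τ (φ t x)

theorem measurable_comp_orbit (hτ : Measurable τ) (x : B) : Measurable fun t => τ (φ t x) :=
  hτ.comp (measurable_flow_orbit φ x)

theorem isProbabilityMeasure_empiricalMeasure (hτ : Measurable τ) (x : B) (n : ℕ) :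
    IsProbabilityMeasure (empiricalMeasure φ τ x n) := by
  have : IsProbabilityMeasure
      ((n + 1 : ENNReal)⁻¹ • volume.restrict (Ioc (0 : ℝ) (n + 1 : ℕ))) := by
    refine ⟨?_⟩
    rw [Measure.smul_apply, Measure.restrict_apply_univ, Real.volume_Ioc, sub_zero,
      ENNReal.ofReal_natCast, smul_eq_mul]
    push_cast
    exact ENNReal.inv_mul_cancel (by simp) (by finiteness)
  exact Measure.isProbabilityMeasure_map (measurable_comp_orbit hτ x).aemeasurable

theorem integral_empiricalMeasure (hτ : Measurable τ) (x : B) (n : ℕ) {h : M → ℝ}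
    (hh : Measurable h) :
    ∫ y, h y ∂(empiricalMeasure φ τ x n)
      = ((n + 1 : ℕ) : ℝ)⁻¹ * ∫ t in (0 : ℝ)..(n + 1 : ℕ), h (τ (φ t x)) := by
  rw [empiricalMeasure, integral_map (measurable_comp_orbit hτ x).aemeasurable
    hh.aestronglyMeasurable, integral_smul_measure,
    intervalIntegral.integral_of_le (Nat.cast_nonneg _), smul_eq_mul]
  congr 1
  rw [ENNReal.toReal_inv]
  norm_cast

variable [SecondCountableTopology B] {μ : Measure B} [IsProbabilityMeasure μ]
  [TopologicalSpace M] [SecondCountableTopology M] [BorelSpace M]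

/-- A countable family of open sets which is stable by intersection and contains a basis. -/
theorem exists_countable_isPiSystem_basis (X : Type*) [TopologicalSpace X]
    [SecondCountableTopology X] : ∃ S : Set (Set X), S.Countable ∧ IsPiSystem S ∧
      (∀ s ∈ S, IsOpen s) ∧ ∀ u, IsOpen u → ∀ x ∈ u, ∃ s ∈ S, x ∈ s ∧ s ⊆ u := by
  obtain ⟨b, hb, -, hbas⟩ := TopologicalSpace.exists_countable_basis X
  refine ⟨sInter '' {t | t.Finite ∧ t ⊆ b}, (Set.countable_ofPred_finite_subset hb).image _,
    ?_, ?_, ?_⟩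
  · rintro _ ⟨s, hs, rfl⟩ _ ⟨t, ht, rfl⟩ -
    exact ⟨s ∪ t, ⟨hs.1.union ht.1, union_subset hs.2 ht.2⟩, sInter_union s t⟩
  · rintro _ ⟨s, hs, rfl⟩
    exact hs.1.isOpen_sInter fun u hu => hbas.isOpen (hs.2 hu)
  · intro u hu x hx
    obtain ⟨v, hv, hxv, hvu⟩ := hbas.exists_subset_of_mem_open hx hu
    exact ⟨v, ⟨{v}, ⟨finite_singleton v, singleton_subset_iff.2 hv⟩, sInter_singleton v⟩, hxv, hvu⟩

/-- For an ergodic flow and a measurable map `τ`, almost every orbit is equidistributed, after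
composition with `τ`, towards the image measure. -/
theorem ae_forall_tendsto_timeAverage (hφ : IsErgodicInvariant φ μ) (hτ : Measurable τ) :
    ∀ᵐ x ∂μ, ∀ h : M → ℝ, Continuous h → ∀ C : ℝ, (∀ y, |h y| ≤ C) →
      Tendsto (fun T : ℝ => (1 / T) * ∫ t in (0 : ℝ)..T, h (τ (φ t x))) atTop
        (𝓝 (∫ y, h y ∂(μ.map τ))) := by
  obtain ⟨S, hSc, hSpi, hSo, hSb⟩ := exists_countable_isPiSystem_basis M
  -- The null set must not depend on h. Convergence is required only for the countably many
  -- indicators of members of S, which is enough for weak convergence of the empirical measures.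
  have key : ∀ᵐ x ∂μ, ∀ s ∈ S, Tendsto (fun n : ℕ => (n : ℝ)⁻¹ *
      ∫ t in (0 : ℝ)..n, (s.indicator (1 : M → ℝ)) (τ (φ t x))) atTop
        (𝓝 (∫ x, (s.indicator (1 : M → ℝ)) (τ x) ∂μ)) := by
    rw [ae_ball_iff hSc]
    intro s hs
    have hm : Measurable (s.indicator (1 : M → ℝ)) :=
      measurable_one.indicator (hSo s hs).measurableSet
    exact ae_tendsto_timeAverage hφ (hm.comp hτ) (C := 1) fun x => by
      by_cases h : τ x ∈ s <;> simp [h]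
  have : IsProbabilityMeasure (μ.map τ) := Measure.isProbabilityMeasure_map hτ.aemeasurable
  filter_upwards [key] with x hx h hh C hC
  refine tendsto_timeAverage_of_nat (hh.measurable.comp (measurable_comp_orbit hτ x))
    (fun t => hC _) ?_
  -- The shift matches the empirical measures, which run up to time n + 1 so that they are
  -- probability measures for every n.
  rw [← tendsto_add_atTop_iff_nat 1]
  let P : ℕ → ProbabilityMeasure M := fun n =>
    ⟨empiricalMeasure φ τ x n, isProbabilityMeasure_empiricalMeasure hτ x n⟩
  have hP : Tendsto P atTop (𝓝 (⟨μ.map τ, inferInstance⟩ : ProbabilityMeasure M)) := by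
    refine hSpi.tendsto_probabilityMeasure_of_tendsto_of_mem
      (fun s hs => (hSo s hs).measurableSet) ?_ ?_
    · intro u hu y hy
      obtain ⟨s, hs, hys, hsu⟩ := hSb u hu y hy
      exact ⟨s, hs, (hSo s hs).mem_nhds hys, hsu⟩
    · intro s hs
      have hsm := (hSo s hs).measurableSet
      have hm : Measurable (s.indicator (1 : M → ℝ)) := measurable_one.indicator hsm
      rw [← NNReal.tendsto_coe]
      have h1 := (tendsto_add_atTop_iff_nat 1).2 (hx s hs)
      rw [← integral_map hτ.aemeasurable hm.aestronglyMeasurable, integral_indicator_one hsm] at h1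
      refine h1.congr fun n => ?_
      rw [← integral_empiricalMeasure hτ x n hm, integral_indicator_one hsm]
      rfl
  have h2 := (ProbabilityMeasure.tendsto_iff_forall_integral_tendsto.1 hP)
    (BoundedContinuousFunction.ofNormedAddCommGroup h hh C hC)
  refine h2.congr fun n => ?_
  exact integral_empiricalMeasure hτ x n hh.measurable

end TimeAverage

/-! ### Continuity of the lifted flows -/

section LiftedFlow

variable {B : Type*} [TopologicalSpace B] {x₀ : B}

/-- Two paths which factor, with the same ends, through a simply connected space are homotopic. -/
theorem Path.homotopic_of_factor {X : Type*} [TopologicalSpace X] [SimplyConnectedSpace X]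
    {f : X → B} (hf : Continuous f) {a b : X} (p q : Path a b) {x y : B} (P Q : Path x y)
    (hP : ∀ t, P t = f (p t)) (hQ : ∀ t, Q t = f (q t)) : P.Homotopic Q := by
  obtain rfl : f a = x := by simpa using (hP 0).symm
  obtain rfl : f b = y := by simpa using (hP 1).symm
  obtain rfl : P = p.map hf := Path.ext (funext hP)
  obtain rfl : Q = q.map hf := Path.ext (funext hQ)
  exact (SimplyConnectedSpace.paths_homotopic p q).map ⟨f, hf⟩

namespace UniversalCover

theorem continuous_pt : Continuous (pt : UniversalCover B x₀ → B) := by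
  refine continuous_def.2 fun V hV => isOpen_def.2 fun b hb => ⟨V, hV, hb, ?_⟩
  rintro c ⟨δ, h1, -⟩
  simpa using h1 1

/-- Both sides are the images of the two ways round the unit square under (s, r) ↦ φ (s t) (δ r).
This commutation is what makes the lifted flow continuous in the space variable. -/
theorem trans_orbitPath (φ : Flow ℝ B) (t : ℝ) {x y : B} (δ : Path x y) :
    Path.Homotopic.Quotient.trans (.mk δ) (.mk (orbitPath φ t y))
      = (Path.Homotopic.Quotient.mk (orbitPath φ t x)).trans
        (.mk (δ.map (φ.continuous continuous_const continuous_id))) := by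
  rw [← Path.Homotopic.Quotient.mk_trans, ← Path.Homotopic.Quotient.mk_trans]
  refine Path.Homotopic.Quotient.eq.2 ?_
  let seg : Path (0 : ℝ) 1 := ⟨⟨fun s => s, continuous_subtype_val⟩, rfl, rfl⟩
  -- Extending δ by constants defines the map on the whole plane, which is simply connected.
  have hf : Continuous fun p : ℝ × ℝ => φ (p.1 * t) (δ.extend p.2) := by fun_prop
  refine Path.homotopic_of_factor hf
    (((Path.refl 0).prod seg).trans (seg.prod (Path.refl 1)))
    ((seg.prod (Path.refl 0)).trans ((Path.refl 1).prod seg)) _ _ (fun r => ?_) (fun r => ?_)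
  · rw [Path.trans_apply, Path.trans_apply]
    split_ifs
    · simpa [seg] using (δ.extend_apply _).symm
    · simp [seg, orbitPath]
  · rw [Path.trans_apply, Path.trans_apply]
    split_ifs
    · simp [seg, orbitPath]
    · simpa [seg] using congrArg (φ t) (δ.extend_apply _).symm

theorem continuous_flow (φ : Flow ℝ B) (t : ℝ) :
    Continuous (flow φ t : UniversalCover B x₀ → UniversalCover B x₀) := by
  refine continuous_def.2 fun s hs => isOpen_def.2 fun b hb => ?_
  obtain ⟨V, hV, hbV, h⟩ := hs _ hb
  refine ⟨φ t ⁻¹' V, hV.preimage (φ.continuous continuous_const continuous_id), hbV,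
    fun c ⟨δ, h1, h2⟩ => h ⟨δ.map (φ.continuous continuous_const continuous_id), h1, ?_⟩⟩
  refine Eq.trans ?_ (Path.Homotopic.Quotient.trans_assoc b.cls (.mk (orbitPath φ t b.pt)) _).symm
  change c.cls.trans _ = _
  rw [h2, Path.Homotopic.Quotient.trans_assoc, trans_orbitPath]
  rfl

/-- For t near t₀ the two lifted points differ by a short piece of orbit inside V: the segment from
0 to t and the broken path through t₀ are homotopic in ℝ. -/
theorem continuous_flow_time (φ : Flow ℝ B) (b : UniversalCover B x₀) :
    Continuous fun t : ℝ => flow φ t b := by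
  refine continuous_def.2 fun s hs => isOpen_iff_mem_nhds.2 fun t₀ ht₀ => ?_
  obtain ⟨V, hV, hbV, h⟩ := hs _ ht₀
  have hx : Continuous fun t : ℝ => φ t b.pt := by fun_prop
  obtain ⟨r, hr, hrV⟩ := Metric.isOpen_iff.1 (hV.preimage hx) t₀ hbV
  refine mem_of_superset (Metric.ball_mem_nhds t₀ hr) fun t ht => h ?_
  let seg (u v : ℝ) : Path u v :=
    { toFun := fun s => AffineMap.lineMap u v (s : ℝ)
      continuous_toFun := AffineMap.lineMap_continuous.comp continuous_subtype_val
      source' := by simp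
      target' := by simp }
  refine ⟨(seg t₀ t).map hx, fun s => hrV ((convex_ball t₀ r).lineMap_mem
    (Metric.mem_ball_self hr) ht s.2), ?_⟩
  refine Eq.trans ?_ (Path.Homotopic.Quotient.trans_assoc b.cls (.mk (orbitPath φ t₀ b.pt)) _).symm
  refine congrArg b.cls.trans ((Path.Homotopic.Quotient.eq.2 ?_).trans
    (Path.Homotopic.Quotient.mk_trans (orbitPath φ t₀ b.pt) ((seg t₀ t).map hx)))
  refine Path.homotopic_of_factor hx (seg 0 t) ((seg 0 t₀).trans (seg t₀ t)) _ _
    (fun s => ?_) (fun s => ?_)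
  · simp [seg, orbitPath, AffineMap.lineMap_apply]
  · rw [Path.trans_apply, Path.trans_apply]
    split_ifs
    · simp [seg, orbitPath, AffineMap.lineMap_apply]
    · simp [seg]

end UniversalCover

namespace Suspension

variable {Q : Type*} [Group Q] {X : Type*} [MulAction Q X] {ρ : FundamentalGroup B x₀ →* Q}

theorem exists_eq_mk {b : UniversalCover B x₀} (e : Suspension ρ X) (h : b.pt = proj e) :
    ∃ y, e = mk ρ b y := by
  obtain ⟨c, y, rfl⟩ := exists_mk e
  obtain ⟨g, rfl⟩ := UniversalCover.exists_smul_eq (b := c) (c := b) h.symm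
  exact ⟨ρ g • y, mk_eq_mk.2 ⟨g, rfl, rfl⟩⟩

theorem mk_right_injective (b : UniversalCover B x₀) :
    Function.Injective (mk ρ b : X → Suspension ρ X) := by
  intro y z h
  obtain ⟨g, h1, h2⟩ := mk_eq_mk.1 h
  obtain rfl := UniversalCover.eq_of_smul_eq h1.symm
  rw [h2, map_one, one_smul]

variable [TopologicalSpace X]

theorem continuous_proj : Continuous (proj : Suspension ρ X → B) :=
  continuous_coinduced_dom.2 (UniversalCover.continuous_pt.comp continuous_fst)

/-- Separate continuity is all that is used: in the point, to make Φ_t Borel; in time, to make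
functions along orbits measurable. -/
theorem continuous_flow (φ : Flow ℝ B) (t : ℝ) :
    Continuous (flow φ t : Suspension ρ X → Suspension ρ X) :=
  continuous_coinduced_dom.2 (continuous_mk.comp
    (((UniversalCover.continuous_flow φ t).comp continuous_fst).prodMk continuous_snd))

theorem continuous_flow_time (φ : Flow ℝ B) (e : Suspension ρ X) :
    Continuous fun t : ℝ => flow φ t e := by
  obtain ⟨b, y, rfl⟩ := exists_mk e
  exact continuous_mk.comp ((UniversalCover.continuous_flow_time φ b).prodMk continuous_const)

end Suspension

end LiftedFlow

/-! ### Local triviality and countability -/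

section Trivial

variable {d : ℕ} {B : Type*} [TopologicalSpace B] [ChartedSpace (EuclideanSpace ℝ (Fin d)) B]
  {x₀ : B}

theorem localLift_pt (b : UniversalCover B x₀) (u : chartBall d b.pt) :
    (localLift b u).pt = (chartAt (EuclideanSpace ℝ (Fin d)) b.pt).symm u := rfl

/-- Local trivialisation over a chart ball. It is injective because the local lift separates base
points and the deck group acts freely. -/
theorem isOpenEmbedding_mk_localLift {Q : Type*} [Group Q] {X : Type*} [MulAction Q X]
    [TopologicalSpace X] [ContinuousConstSMul Q X] (ρ : FundamentalGroup B x₀ →* Q)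
    (b : UniversalCover B x₀) :
    IsOpenEmbedding fun p : chartBall d b.pt × X => Suspension.mk ρ (localLift b p.1) p.2 := by
  have h := (isOpenEmbedding_localLift (d := d) b).prodMap (IsOpenEmbedding.id (X := X))
  refine .of_continuous_injective_isOpenMap (Suspension.continuous_mk.comp h.continuous) ?_
    (Suspension.isOpenMap_mk.comp h.isOpenMap)
  rintro ⟨u, z⟩ ⟨v, w⟩ huv
  obtain rfl : u = v := localLift_pt_injective b (congrArg Suspension.proj huv)
  exact Prod.ext rfl (Suspension.mk_right_injective _ huv)

variable (d x₀) in
theorem exists_countable_cover_localLift [SecondCountableTopology B] [PathConnectedSpace B] :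
    ∃ s : Set (UniversalCover B x₀), s.Countable ∧
      ∀ x, ∃ b ∈ s, ∃ u : chartBall d b.pt, (localLift b u).pt = x := by
  obtain ⟨s, hs, hU⟩ := TopologicalSpace.countable_cover_nhds (α := B)
    (f := fun x => (chartAt (EuclideanSpace ℝ (Fin d)) x).source ∩
      chartAt (EuclideanSpace ℝ (Fin d)) x ⁻¹' chartBall d x)
    fun x => (isOpen_chart_preimage x (isOpen_chartBall x)).mem_nhds
      ⟨mem_chart_source _ x, center_mem_chartBall x⟩
  choose c hc using fun x : B => UniversalCover.exists_pt_eq (x₀ := x₀) x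
  refine ⟨c '' s, hs.image c, fun x => ?_⟩
  obtain ⟨y, hy, hxy⟩ := mem_iUnion₂.1 (hU.symm ▸ mem_univ x)
  obtain ⟨h1, h2⟩ : x ∈ (chartAt (EuclideanSpace ℝ (Fin d)) (c y).pt).source ∩
      chartAt (EuclideanSpace ℝ (Fin d)) (c y).pt ⁻¹' chartBall d (c y).pt := by
    rw [hc]; exact hxy
  exact ⟨c y, ⟨y, hy, rfl⟩, ⟨_, h2⟩, (chartAt _ (c y).pt).left_inv h1⟩

/-- By Lindelöf, countably many trivialised pieces cover the total space. Countability of the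
fundamental group is not needed. -/
theorem secondCountableTopology_suspension (d : ℕ) {B : Type*} [TopologicalSpace B]
    [ChartedSpace (EuclideanSpace ℝ (Fin d)) B] {x₀ : B} [SecondCountableTopology B] [PathConnectedSpace B]
    {Q : Type*} [Group Q] {X : Type*} [MulAction Q X]
    [TopologicalSpace X] [SecondCountableTopology X] [ContinuousConstSMul Q X]
    (ρ : FundamentalGroup B x₀ →* Q) : SecondCountableTopology (Suspension ρ X) := by
  obtain ⟨s, hs, hU⟩ := exists_countable_cover_localLift d x₀
  have : Countable s := hs
  have hemb := fun b : s => isOpenEmbedding_mk_localLift (d := d) (X := X) ρ b.1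
  have hsc : ∀ b : s, SecondCountableTopology
      (range fun p : chartBall d b.1.pt × X => Suspension.mk ρ (localLift b.1 p.1) p.2) :=
    fun b => (hemb b).toIsEmbedding.toHomeomorph.symm.isInducing.secondCountableTopology
  refine TopologicalSpace.secondCountableTopology_of_countable_cover
    (fun b : s => (hemb b).isOpen_range) (eq_univ_of_forall fun e => ?_)
  obtain ⟨b, hb, u, hu⟩ := hU e.proj
  obtain ⟨y, hy⟩ := Suspension.exists_eq_mk e hu
  exact mem_iUnion.2 ⟨⟨b, hb⟩, (u, y), hy.symm⟩

theorem secondCountableTopology_projectivization (m : ℕ) :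
    SecondCountableTopology (ℙ ℂ (Fin (m + 1) → ℂ)) := by
  have hsc : ∀ i : Fin (m + 1), SecondCountableTopology (range (affineParam i)) := fun i =>
    (isOpenEmbedding_affineParam i).toIsEmbedding.toHomeomorph.symm.isInducing.secondCountableTopology
  refine TopologicalSpace.secondCountableTopology_of_countable_cover
    (fun i => (isOpenEmbedding_affineParam i).isOpen_range) (eq_univ_of_forall fun l => ?_)
  obtain ⟨i, z, h⟩ := exists_affineParam l
  exact mem_iUnion.2 ⟨i, z, h⟩

instance {m : ℕ} : ContinuousConstSMul (GL (Fin (m + 1)) ℂ) (Fin (m + 1) → ℂ) where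
  continuous_const_smul _ := Continuous.matrix_mulVec continuous_const continuous_id

theorem continuous_projectivization_mk {m : ℕ} :
    Continuous fun v : {v : Fin (m + 1) → ℂ // v ≠ 0} => Projectivization.mk ℂ v.1 v.2 :=
  continuous_coinduced_rng

end Trivial

/-! ### Lebesgue null sets -/

section Null

variable {H : Type*} [TopologicalSpace H] [MeasureSpace H] [BorelSpace H]
  {B : Type*} [TopologicalSpace B] [MeasurableSpace B] [BorelSpace B]

theorem OpenPartialHomeomorph.aemeasurable_restrict_source (e : OpenPartialHomeomorph B H)
    (μ : Measure B) : AEMeasurable e (μ.restrict e.source) :=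
  e.continuousOn.aemeasurable e.open_source.measurableSet

/-- The image is a preimage under the continuous inverse on the open target, so no theorem on
injective Borel images is involved. -/
theorem OpenPartialHomeomorph.measurableSet_image (e : OpenPartialHomeomorph B H) {s : Set B}
    (hs : MeasurableSet s) : MeasurableSet (e '' (s ∩ e.source)) := by
  have h1 := (continuousOn_iff_continuous_domRestrict.1 e.symm.continuousOn).measurable hs
  have h2 : e '' (s ∩ e.source) = Subtype.val '' (e.symm.source.domRestrict e.symm ⁻¹' s) := by
    rw [inter_comm, e.image_source_inter_eq' s]
    ext y
    exact ⟨fun ⟨h3, h4⟩ => ⟨⟨y, h3⟩, h4, rfl⟩, fun ⟨⟨z, h3⟩, h4, h5⟩ => h5 ▸ ⟨h3, h4⟩⟩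
  rw [h2]
  exact MeasurableSet.subtype_image e.open_target.measurableSet h1

variable [ChartedSpace H B] {μ : Measure B}

/-- A measure and its multiple by a positive density have the same null sets. Measurable null
supersets reduce arbitrary s to the measurable case. -/
theorem HasPositiveDensity.volume_image_eq_zero_iff (hμ : HasPositiveDensity H μ)
    {e : OpenPartialHomeomorph B H} (he : e ∈ atlas H B) {s : Set B} :
    volume (e '' (s ∩ e.source)) = 0 ↔ μ (s ∩ e.source) = 0 := by
  obtain ⟨f, hf, hpos, hmap⟩ := hμ e he
  have hae := e.aemeasurable_restrict_source μ
  constructor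
  · intro h
    obtain ⟨Z, hZ, hZm, hZ0⟩ := exists_measurable_superset_of_null h
    have h1 : ((volume.restrict e.target).withDensity f) Z = 0 :=
      withDensity_absolutelyContinuous _ _ (Measure.absolutelyContinuous_of_le
        Measure.restrict_le_self hZ0)
    rw [← hmap, Measure.map_apply_of_aemeasurable hae hZm,
      Measure.restrict_apply' e.open_source.measurableSet] at h1
    exact measure_mono_null (fun x hx => mem_inter (hZ ⟨x, hx, rfl⟩) hx.2) h1
  · intro h
    obtain ⟨t, ht, htm, ht0⟩ := exists_measurable_superset_of_null h
    have hZm := e.measurableSet_image htm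
    have h1 : ((μ.restrict e.source).map e) (e '' (t ∩ e.source)) = 0 := by
      rw [Measure.map_apply_of_aemeasurable hae hZm,
        Measure.restrict_apply' e.open_source.measurableSet]
      refine measure_mono_null ?_ ht0
      rintro x ⟨⟨y, hy, hyx⟩, hx⟩
      rw [← e.injOn hy.2 hx hyx]
      exact hy.1
    -- Only this direction uses positivity: the density vanishes nowhere on the target.
    rw [hmap, withDensity_apply_eq_zero hf, Measure.restrict_apply' e.open_target.measurableSet]
      at h1
    refine measure_mono_null ?_ h1
    rintro _ ⟨x, hx, rfl⟩
    exact ⟨⟨(hpos _ (e.map_source hx.2)).ne', x, ⟨ht hx, hx.2⟩, rfl⟩, e.map_source hx.2⟩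

theorem HasPositiveDensity.lebesgueNull (hμ : HasPositiveDensity H μ) {s : Set B}
    (hs : μ s = 0) : LebesgueNull H s := fun _ he =>
  (hμ.volume_image_eq_zero_iff he).2 (measure_mono_null inter_subset_left hs)

theorem HasPositiveDensity.measure_eq_zero [SecondCountableTopology B]
    (hμ : HasPositiveDensity H μ) {s : Set B} (hs : LebesgueNull H s) : μ s = 0 := by
  obtain ⟨c, hc, hU⟩ := TopologicalSpace.countable_cover_nhds
    (f := fun x : B => (chartAt H x).source) fun x => chart_source_mem_nhds H x
  have h1 : s = ⋃ x ∈ c, s ∩ (chartAt H x).source := by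
    rw [← inter_iUnion₂, hU, inter_univ]
  rw [h1, measure_biUnion_null_iff hc]
  exact fun x _ => (hμ.volume_image_eq_zero_iff (chart_mem_atlas H x)).1
    (hs _ (chart_mem_atlas H x))

end Null

/-! ### Hyperplanes in affine coordinates. -/

section Hyperplane

variable {m : ℕ}

/-- The set is a real affine subspace of ℂᵐ, and proper ones are Haar null. It is proper because the
vectors with i-th coordinate 1 span everything. -/
theorem volume_setOf_insertNth_mem (i : Fin (m + 1)) (W : Submodule ℂ (Fin (m + 1) → ℂ))
    (hW : W ≠ ⊤) : volume {z : Fin m → ℂ | i.insertNth (α := fun _ => ℂ) 1 z ∈ W} = 0 := by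
  let S : AffineSubspace ℝ (Fin m → ℂ) :=
    { carrier := {z : Fin m → ℂ | i.insertNth (α := fun _ => ℂ) 1 z ∈ W}
      smul_vsub_vadd_mem' := by
        intro c p₁ p₂ p₃ h₁ h₂ h₃
        have : i.insertNth (α := fun _ => ℂ) 1 (c • (p₁ -ᵥ p₂) +ᵥ p₃)
            = (c : ℂ) • (i.insertNth (α := fun _ => ℂ) 1 p₁ - i.insertNth (α := fun _ => ℂ) 1 p₂)
              + i.insertNth (α := fun _ => ℂ) 1 p₃ := by
          ext j
          refine Fin.succAboveCases i ?_ (fun j => ?_) j <;> simp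
        rw [mem_ofPred_eq, this]
        exact W.add_mem (W.smul_mem _ (W.sub_mem h₁ h₂)) h₃ }
  refine Measure.addHaar_affineSubspace volume S fun hS => hW ?_
  have hall : ∀ z : Fin m → ℂ, i.insertNth (α := fun _ => ℂ) 1 z ∈ W := fun z => by
    have : z ∈ S := hS ▸ AffineSubspace.mem_top ℝ _ z
    exact this
  refine Submodule.eq_top_iff'.2 fun v => ?_
  have : v = (i.insertNth (α := fun _ => ℂ) 1 (fun j => v (i.succAbove j))
      - i.insertNth (α := fun _ => ℂ) 1 0) + v i • i.insertNth (α := fun _ => ℂ) 1 0 := by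
    ext j
    refine Fin.succAboveCases i ?_ (fun j => ?_) j <;> simp
  rw [this]
  exact W.add_mem (W.sub_mem (hall _) (hall _)) (W.smul_mem _ (hall _))

/-- The affine hyperplanes spanned by a measurable family of frames form a null set. -/
theorem volume_setOf_insertNth_mem_span {U : Type*} [MeasureSpace U] [SFinite (volume : Measure U)]
    (i : Fin (m + 1)) {v : Fin m → U → Fin (m + 1) → ℂ} (hv : ∀ j, Measurable (v j)) {D : Set U}
    (hD : MeasurableSet D) (hind : ∀ u ∈ D, LinearIndependent ℂ fun j => v j u) :
    volume {p : U × (Fin m → ℂ) | p.1 ∈ D ∧ i.insertNth (α := fun _ => ℂ) 1 p.2 ∈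
      Submodule.span ℂ (range fun j => v j p.1)} = 0 := by
  -- Over D, lying in the span means that this determinant vanishes, which shows that the set is
  -- measurable, as Fubini requires.
  let P : U × (Fin m → ℂ) → Matrix (Fin (m + 1)) (Fin (m + 1)) ℂ := fun p =>
    Matrix.of (Fin.cons (i.insertNth (α := fun _ => ℂ) 1 p.2) fun j => v j p.1)
  have hP : ∀ p, p.1 ∈ D → ((P p).det = 0 ↔ i.insertNth (α := fun _ => ℂ) 1 p.2 ∈
      Submodule.span ℂ (range fun j => v j p.1)) := by
    intro p hp
    have h1 : LinearIndependent ℂ (P p).row ↔ (P p).det ≠ 0 := by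
      rw [Matrix.linearIndependent_rows_iff_isUnit, Matrix.isUnit_iff_isUnit_det, isUnit_iff_ne_zero]
    have h2 : LinearIndependent ℂ (P p).row ↔ _ := linearIndependent_finCons
    rw [h1] at h2
    have h3 := hind p.1 hp
    tauto
  have hm : MeasurableSet {p : U × (Fin m → ℂ) | p.1 ∈ D ∧ (P p).det = 0} := by
    have hPm : ∀ k l, Measurable fun p => P p k l := by
      intro k l
      refine Fin.cases ?_ (fun j => ?_) k
      · change Measurable fun p : U × (Fin m → ℂ) => i.insertNth (α := fun _ => ℂ) 1 p.2 l
        refine Fin.succAboveCases i ?_ (fun j => ?_) l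
        · simp
        · simpa using (measurable_pi_apply j).fun_comp measurable_snd
      · exact (measurable_pi_apply l).comp ((hv j).comp measurable_fst)
    have hdet : Measurable fun p => (P p).det := by
      simp only [Matrix.det_apply]
      exact Finset.measurable_fun_sum _ fun g _ =>
        (Finset.measurable_fun_prod _ fun k _ => hPm _ _).const_smul _
    exact (measurable_fst hD).inter (hdet (measurableSet_singleton 0))
  have hset : {p : U × (Fin m → ℂ) | p.1 ∈ D ∧ i.insertNth (α := fun _ => ℂ) 1 p.2 ∈
      Submodule.span ℂ (range fun j => v j p.1)}
        = {p : U × (Fin m → ℂ) | p.1 ∈ D ∧ (P p).det = 0} := by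
    ext p
    exact and_congr_right fun hp => (hP p hp).symm
  rw [hset, Measure.volume_eq_prod, Measure.measure_prod_null hm]
  refine ae_of_all _ fun u => ?_
  by_cases hu : u ∈ D
  · refine measure_mono_null (fun z hz => (hP (u, z) hu).1 hz.2)
      (volume_setOf_insertNth_mem i (Submodule.span ℂ (range fun j => v j u)) fun htop => ?_)
    -- m vectors cannot span a space of dimension m + 1.
    have h1 := finrank_range_le_card (R := ℂ) fun j => v j u
    rw [Set.finrank, htop, finrank_top] at h1
    simp at h1
  · exact measure_mono_null (fun z hz => absurd hz.1 hu) measure_empty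

end Hyperplane

/-! ### Sets of the suspension read in charts. -/

section ChartImage

variable {d m : ℕ} {B : Type*} [TopologicalSpace B] [ChartedSpace (EuclideanSpace ℝ (Fin d)) B]
  {x₀ : B} {Q : Type*} [Group Q] [MulAction Q (ℙ ℂ (Fin (m + 1) → ℂ))]
  [ContinuousConstSMul Q (ℙ ℂ (Fin (m + 1) → ℂ))] (ρ : FundamentalGroup B x₀ →* Q)

theorem Suspension.chart_image (b : UniversalCover B x₀) (i : Fin (m + 1))
    (s : Set (Suspension ρ (ℙ ℂ (Fin (m + 1) → ℂ)))) :
    chart (d := d) ρ b i '' (s ∩ (chart (d := d) ρ b i).source)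
      = {p : EuclideanSpace ℝ (Fin d) × (Fin m → ℂ) |
          ∃ hu : p.1 ∈ chartBall d b.pt, chartParam (d := d) ρ b i (⟨p.1, hu⟩, p.2) ∈ s} := by
  have hne : Nonempty (chartBall d b.pt) := ⟨⟨_, center_mem_chartBall b.pt⟩⟩
  have h1 : ∀ q : chartBall d b.pt × (Fin m → ℂ),
      chart (d := d) ρ b i (chartParam ρ b i q) = (q.1.1, q.2) := by
    intro q
    have h2 : ((isOpenEmbedding_chartParam (d := d) ρ b i).toOpenPartialHomeomorph _).symm
        (chartParam ρ b i q) = q :=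
      ((isOpenEmbedding_chartParam (d := d) ρ b i).toOpenPartialHomeomorph _).left_inv (by simp)
    rw [chart, OpenPartialHomeomorph.coe_trans, Function.comp_apply, h2]
    rfl
  rw [chart_source]
  ext ⟨u, z⟩
  constructor
  · rintro ⟨_, ⟨h, q, rfl⟩, h3⟩
    rw [h1] at h3
    obtain ⟨rfl, rfl⟩ := Prod.mk.inj h3
    exact ⟨q.1.2, h⟩
  · rintro ⟨hu, h⟩
    exact ⟨_, ⟨h, _, rfl⟩, h1 _⟩

end ChartImage

/-! ### Attraction towards the direction of largest expansion -/

section Attraction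

variable {d m : ℕ} {B : Type*} [TopologicalSpace B] {x₀ : B}
  {ρ : FundamentalGroup B x₀ →* GL (Fin (m + 1)) ℂ}

theorem mk_projRep_eq_of_mk_eq {b c : UniversalCover B x₀} {v w : Fin (m + 1) → ℂ} (hv : v ≠ 0)
    (hw : w ≠ 0) (h : Suspension.mk ρ b v = Suspension.mk ρ c w) :
    Suspension.mk (projRep ρ) b (Projectivization.mk ℂ v hv) = Suspension.mk (projRep ρ) c (Projectivization.mk ℂ w hw) := by
  obtain ⟨g, rfl, rfl⟩ := Suspension.mk_eq_mk.1 h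
  exact Suspension.mk_eq_mk.2 ⟨g, rfl, rfl⟩

theorem tendsto_mk_projRep {α : Type*} {l : Filter α} {c : α → UniversalCover B x₀}
    {f : α → Fin (m + 1) → ℂ} (hf : ∀ a, f a ≠ 0) {b : UniversalCover B x₀} {v : Fin (m + 1) → ℂ}
    (hv : v ≠ 0) (hc : Tendsto c l (𝓝 b)) (hfv : Tendsto f l (𝓝 v)) :
    Tendsto (fun a => Suspension.mk (projRep ρ) (c a) (Projectivization.mk ℂ (f a) (hf a))) l
      (𝓝 (Suspension.mk (projRep ρ) b (Projectivization.mk ℂ v hv))) := by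
  have h1 : Tendsto (fun a => (⟨f a, hf a⟩ : {v : Fin (m + 1) → ℂ // v ≠ 0})) l (𝓝 ⟨v, hv⟩) :=
    tendsto_subtype_rng.2 hfv
  have h2 := (continuous_projectivization_mk.tendsto _).comp h1
  exact (Suspension.continuous_mk.tendsto (b, Projectivization.mk ℂ v hv)).comp
    (hc.prodMk_nhds h2)

theorem exists_GL_mk_eq {b c : UniversalCover B x₀} (h : b.pt = c.pt) :
    ∃ L : GL (Fin (m + 1)) ℂ, ∀ w : Fin (m + 1) → ℂ,
      Suspension.mk ρ b w = Suspension.mk ρ c (L • w) := by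
  obtain ⟨g, rfl⟩ := UniversalCover.exists_smul_eq h
  exact ⟨ρ g, fun w => Suspension.mk_eq_mk.2 ⟨g, rfl, rfl⟩⟩

namespace HermitianMetric

variable (N : HermitianMetric ρ) (b : UniversalCover B x₀)

theorem norm_smul (a : ℂ) (w : Fin (m + 1) → ℂ) :
    N.norm (Suspension.mk ρ b (a • w)) = ‖a‖ * N.norm (Suspension.mk ρ b w) := by
  obtain ⟨M, -, hM⟩ := N.hermitian b
  rw [← sq_eq_sq₀ (N.norm_nonneg _) (mul_nonneg (_root_.norm_nonneg _) (N.norm_nonneg _)), mul_pow, hM,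
    hM, Matrix.mulVec_smul, star_smul, smul_dotProduct, dotProduct_smul, smul_eq_mul, smul_eq_mul,
    ← mul_assoc, Complex.star_def, ← Complex.normSq_eq_conj_mul_self, Complex.re_ofReal_mul,
    Complex.normSq_eq_norm_sq]

theorem norm_pos {w : Fin (m + 1) → ℂ} (hw : w ≠ 0) : 0 < N.norm (Suspension.mk ρ b w) := by
  obtain ⟨M, hM, h⟩ := N.hermitian b
  have h1 : 0 < (star w ⬝ᵥ M.mulVec w).re := hM.re_dotProduct_pos hw
  rw [← h w] at h1
  exact (N.norm_nonneg _).lt_of_ne fun h0 => by simp [← h0] at h1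

end HermitianMetric

/-- The lifted orbit of b need not converge in the universal cover when its base point does. A local
section replaces it by lifts that converge, at the cost of a monodromy matrix. -/
theorem exists_localSection [ChartedSpace (EuclideanSpace ℝ (Fin d)) B]
    (b : UniversalCover B x₀) : ∃ s : B → UniversalCover B x₀,
      Tendsto s (𝓝 b.pt) (𝓝 b) ∧ ∀ᶠ x in 𝓝 b.pt, (s x).pt = x := by
  classical
  let e := chartAt (EuclideanSpace ℝ (Fin d)) b.pt
  let O : Set B := e.source ∩ e ⁻¹' chartBall d b.pt
  have hO : IsOpen O := isOpen_chart_preimage b.pt (isOpen_chartBall b.pt)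
  have hbO : b.pt ∈ O := ⟨mem_chart_source _ _, center_mem_chartBall _⟩
  let s : B → UniversalCover B x₀ := fun x =>
    if h : e x ∈ chartBall d b.pt then localLift b ⟨e x, h⟩ else b
  have hs : ∀ x (h : x ∈ O), s x = localLift b ⟨e x, h.2⟩ := fun x h => dif_pos h.2
  have hsb : s b.pt = b := by
    rw [hs _ hbO]
    exact localLift_center b
  refine ⟨s, ?_, ?_⟩
  · have hc : ContinuousOn s O := by
      rw [continuousOn_iff_continuous_domRestrict]
      have h1 : Continuous fun x : O => (⟨e x, x.2.2⟩ : chartBall d b.pt) :=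
        ((continuousOn_iff_continuous_domRestrict.1
          (e.continuousOn.mono inter_subset_left))).subtype_mk _
      have h2 : O.domRestrict s = fun x : O => localLift b ⟨e x, x.2.2⟩ :=
        funext fun x => hs x x.2
      rw [h2]
      exact (isOpenEmbedding_localLift b).continuous.comp h1
    have h3 := (hc.continuousAt (hO.mem_nhds hbO)).tendsto
    rwa [hsb] at h3
  · filter_upwards [hO.mem_nhds hbO] with x hx
    rw [hs x hx, localLift_pt]
    exact e.left_inv hx.1

/-- Turns the expansion hypothesis, stated for sequences of visits to K, into a limit along a filter
that an ultrafilter can refine. -/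
theorem tendsto_inf_principal_of_seq {α : Type*} {l : Filter α} {r : ℝ → α} {S : Set ℝ}
    (h : ∀ t : ℕ → ℝ, Tendsto t atTop atTop → (∀ n, t n ∈ S) → Tendsto (fun n => r (t n)) atTop l) :
    Tendsto r (atTop ⊓ 𝓟 S) l := by
  refine tendsto_of_seq_tendsto fun t ht => ?_
  rw [tendsto_inf, tendsto_principal] at ht
  obtain ⟨k, hk⟩ := eventually_atTop.1 ht.2
  rw [← tendsto_add_atTop_iff_nat k]
  exact h (fun n => t (n + k)) ((tendsto_add_atTop_iff_nat k).2 ht.1) fun n => hk _ (by omega)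

/-- In suitable positions, the projective classes of `L (w₁ + w₂)` and `L w₁` get close if `L w₂` is
negligible with respect to `L w₁`. -/
theorem exists_tendsto_mk_projRep (N : HermitianMetric ρ) (g : Ultrafilter ℝ)
    {c : ℝ → UniversalCover B x₀} {b : UniversalCover B x₀} (hc : Tendsto c g (𝓝 b))
    (L : ℝ → GL (Fin (m + 1)) ℂ) {w₁ w₂ : Fin (m + 1) → ℂ} (hw₁ : w₁ ≠ 0) (hw₂ : w₂ ≠ 0)
    (hw : w₁ + w₂ ≠ 0)
    (hexp : Tendsto (fun t => N.norm (Suspension.mk ρ (c t) (L t • w₁)) /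
      N.norm (Suspension.mk ρ (c t) (L t • w₂))) g atTop) :
    ∃ y, Tendsto (fun t => Suspension.mk (projRep ρ) (c t)
          (Projectivization.mk ℂ (L t • w₁) ((smul_ne_zero_iff_ne _).2 hw₁))) g (𝓝 y) ∧
      Tendsto (fun t => Suspension.mk (projRep ρ) (c t)
          (Projectivization.mk ℂ (L t • (w₁ + w₂)) ((smul_ne_zero_iff_ne _).2 hw))) g (𝓝 y) := by
  have hnz : ∀ {w : Fin (m + 1) → ℂ}, w ≠ 0 → ∀ t, L t • w ≠ 0 := fun h t =>
    (smul_ne_zero_iff_ne _).2 h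
  -- Unit vectors on the lines of L t • w; along the ultrafilter they converge by compactness of the
  -- sphere. Nothing is assumed on the growth of L t.
  let e : (Fin (m + 1) → ℂ) → ℝ → Fin (m + 1) → ℂ := fun w t => ((‖L t • w‖⁻¹ : ℝ) : ℂ) • L t • w
  have hlim : ∀ {w : Fin (m + 1) → ℂ}, w ≠ 0 → ∃ v, v ≠ 0 ∧ Tendsto (e w) g (𝓝 v) := by
    intro w hw
    have hmem : ∀ t, e w t ∈ Metric.sphere (0 : Fin (m + 1) → ℂ) 1 := fun t => by
      rw [mem_sphere_zero_iff_norm, _root_.norm_smul, Complex.norm_real, norm_inv, norm_norm,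
        inv_mul_cancel₀ (norm_ne_zero_iff.2 (hnz hw t))]
    obtain ⟨v, hv, hle⟩ := (isCompact_sphere (0 : Fin (m + 1) → ℂ) 1).ultrafilter_le_nhds'
      (g.map (e w)) (Filter.Eventually.of_forall (p := fun t => e w t ∈ Metric.sphere _ 1) hmem)
    refine ⟨v, ?_, hle⟩
    rintro rfl
    simp at hv
  obtain ⟨v₁, hv₁, ht₁⟩ := hlim hw₁
  obtain ⟨v₂, hv₂, ht₂⟩ := hlim hw₂
  have hN : ∀ {w v : Fin (m + 1) → ℂ}, Tendsto (e w) g (𝓝 v) →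
      Tendsto (fun t => N.norm (Suspension.mk ρ (c t) (e w t))) g
        (𝓝 (N.norm (Suspension.mk ρ b v))) := fun ht =>
    ((N.continuous_norm.comp Suspension.continuous_mk).tendsto (b, _)).comp (hc.prodMk_nhds ht)
  -- The metric norms of the unit vectors have positive limits, by continuity of N at b. So the
  -- ratio of metric norms and that of the coordinate norms diverge together.
  have hq := hexp.atTop_mul_pos (div_pos (N.norm_pos b hv₂) (N.norm_pos b hv₁))
    ((hN ht₂).div (hN ht₁) (N.norm_pos b hv₁).ne')
  have hq' : Tendsto (fun t => ‖L t • w₂‖ / ‖L t • w₁‖) g (𝓝 0) := by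
    refine hq.inv_tendsto_atTop.congr fun t => ?_
    have h1 := (N.norm_pos (c t) (hnz hw₁ t)).ne'
    have h2 := (N.norm_pos (c t) (hnz hw₂ t)).ne'
    have h3 := norm_ne_zero_iff.2 (hnz hw₁ t)
    have h4 := norm_ne_zero_iff.2 (hnz hw₂ t)
    simp only [e, N.norm_smul, Complex.norm_real, norm_inv, norm_norm, Pi.inv_apply, Pi.div_apply]
    field_simp
  -- Normalised by ‖L w₁‖, the image of the sum is the unit vector of w₁ plus ‖L w₂‖/‖L w₁‖ times
  -- that of w₂.
  have hsum : Tendsto (fun t => ((‖L t • w₁‖⁻¹ : ℝ) : ℂ) • L t • (w₁ + w₂)) g (𝓝 v₁) := by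
    have h1 := ht₁.add (((Complex.continuous_ofReal.tendsto _).comp hq').smul ht₂)
    rw [Complex.ofReal_zero, zero_smul, add_zero] at h1
    refine h1.congr fun t => ?_
    have h3 := norm_ne_zero_iff.2 (hnz hw₁ t)
    have h4 := norm_ne_zero_iff.2 (hnz hw₂ t)
    simp only [e, Function.comp_apply, smul_add]
    rw [smul_smul, ← Complex.ofReal_mul]
    congr 3
    field_simp
  have hcoe : ∀ t, ((‖L t • w₁‖⁻¹ : ℝ) : ℂ) ≠ 0 := fun t =>
    Complex.ofReal_ne_zero.2 (inv_ne_zero (norm_ne_zero_iff.2 (hnz hw₁ t)))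
  refine ⟨Suspension.mk (projRep ρ) b (Projectivization.mk ℂ v₁ hv₁), ?_, ?_⟩
  · refine (tendsto_mk_projRep (ρ := ρ) (fun t => smul_ne_zero (hcoe t) (hnz hw₁ t)) hv₁ hc
      ht₁).congr fun t => congrArg _ ?_
    exact (Projectivization.mk_eq_mk_iff' ℂ _ _ _ _).2 ⟨_, rfl⟩
  · refine (tendsto_mk_projRep (ρ := ρ) (fun t => smul_ne_zero (hcoe t) (hnz hw t)) hv₁ hc
      hsum).congr fun t => congrArg _ ?_
    exact (Projectivization.mk_eq_mk_iff' ℂ _ _ _ _).2 ⟨_, rfl⟩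

/-- Along an ultrafilter of times, either the base orbit avoids the projection of the support and
both values are 0, or it converges there and the two projective points have a common limit.
Ultrafilters dispense with a metric on the bundle and with uniform continuity. -/
theorem tendsto_sub_of_expansion (d : ℕ) {B : Type*} [TopologicalSpace B]
    [ChartedSpace (EuclideanSpace ℝ (Fin d)) B] [PathConnectedSpace B] {x₀ : B}
    {ρ : FundamentalGroup B x₀ →* GL (Fin (m + 1)) ℂ} (φ : Flow ℝ B) (N : HermitianMetric ρ)
    (b : UniversalCover B x₀) {w₁ w₂ : Fin (m + 1) → ℂ} (hw₁ : w₁ ≠ 0) (hw : w₁ + w₂ ≠ 0)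
    (hexp : w₂ ≠ 0 → ∀ K : Set B, IsCompact K → ∀ t : ℕ → ℝ, Tendsto t atTop atTop →
      (∀ n, φ (t n) b.pt ∈ K) → Tendsto (fun n =>
        N.norm (Suspension.mk ρ (UniversalCover.flow φ (t n) b) w₁) /
          N.norm (Suspension.mk ρ (UniversalCover.flow φ (t n) b) w₂)) atTop atTop)
    {h : ProjBundle ρ → ℝ} (hh : Continuous h) (hs : HasCompactSupport h) :
    Tendsto (fun t => h (Suspension.flow φ t (Suspension.mk (projRep ρ) b (Projectivization.mk ℂ (w₁ + w₂) hw)))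
      - h (Suspension.flow φ t (Suspension.mk (projRep ρ) b (Projectivization.mk ℂ w₁ hw₁)))) atTop (𝓝 0) := by
  by_cases hw₂ : w₂ = 0
  · subst hw₂
    simp
  replace hexp := hexp hw₂
  rw [tendsto_iff_ultrafilter]
  intro g hg
  have hK : IsCompact (Suspension.proj '' tsupport h) := hs.isCompact.image
    Suspension.continuous_proj
  by_cases hgK : {t : ℝ | φ t b.pt ∈ Suspension.proj '' tsupport h} ∈ g
  swap
  · refine tendsto_const_nhds.congr' ?_
    filter_upwards [Ultrafilter.compl_mem_iff_notMem.2 hgK] with t ht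
    have h0 : ∀ l, h (Suspension.flow φ t (Suspension.mk (projRep ρ) b l)) = 0 := fun l =>
      image_eq_zero_of_notMem_tsupport fun hl => ht ⟨_, hl, rfl⟩
    rw [h0, h0, sub_zero]
  have hr := (tendsto_inf_principal_of_seq (r := fun t =>
    N.norm (Suspension.mk ρ (UniversalCover.flow φ t b) w₁) /
      N.norm (Suspension.mk ρ (UniversalCover.flow φ t b) w₂)) (hexp _ hK)).mono_left
    (le_inf hg (le_principal_iff.2 hgK))
  obtain ⟨x, -, hx⟩ := hK.ultrafilter_le_nhds' (g.map fun t => φ t b.pt) hgK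
  obtain ⟨b', rfl⟩ := UniversalCover.exists_pt_eq (x₀ := x₀) x
  obtain ⟨s, hsb, hspt⟩ := exists_localSection (d := d) b'
  have hx' : Tendsto (fun t => φ t b.pt) g (𝓝 b'.pt) := hx
  have hev : ∀ᶠ t in (g : Filter ℝ), (s (φ t b.pt)).pt = φ t b.pt := hx'.eventually hspt
  have hL : ∀ t, ∃ L : GL (Fin (m + 1)) ℂ, (s (φ t b.pt)).pt = φ t b.pt →
      ∀ w : Fin (m + 1) → ℂ, Suspension.mk ρ (UniversalCover.flow φ t b) w
        = Suspension.mk ρ (s (φ t b.pt)) (L • w) := by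
    intro t
    by_cases ht : (s (φ t b.pt)).pt = φ t b.pt
    · obtain ⟨L, hL⟩ := exists_GL_mk_eq (ρ := ρ) (b := UniversalCover.flow φ t b)
        (c := s (φ t b.pt)) ht.symm
      exact ⟨L, fun _ => hL⟩
    · exact ⟨1, fun h' => absurd h' ht⟩
  choose L hL using hL
  obtain ⟨y, hy₁, hy⟩ := exists_tendsto_mk_projRep N g (hsb.comp hx') L hw₁ hw₂ hw (by
    refine hr.congr' ?_
    filter_upwards [hev] with t ht
    rw [hL t ht, hL t ht]
    rfl)
  have hlim := ((hh.tendsto y).comp hy).sub ((hh.tendsto y).comp hy₁)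
  rw [sub_self] at hlim
  refine hlim.congr' ?_
  filter_upwards [hev] with t ht
  simp only [Function.comp_apply, Suspension.flow_mk]
  rw [mk_projRep_eq_of_mk_eq hw ((smul_ne_zero_iff_ne _).2 hw) (hL t ht _),
    mk_projRep_eq_of_mk_eq hw₁ ((smul_ne_zero_iff_ne _).2 hw₁) (hL t ht _)]

end Attraction

/-! ### Equivariant maps defined almost everywhere -/

section Equivariant

variable {B : Type*} [MeasurableSpace B] {lam : Measure B}

theorem measurePreserving_map_section {M : Type*} [MeasurableSpace M] {τ : B → M}
    {ψ : M → M} {f : B → B} (hτ : AEMeasurable τ lam) (hψ : Measurable ψ)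
    (hf : MeasurePreserving f lam lam) (h : ∀ᵐ x ∂lam, τ (f x) = ψ (τ x)) :
    MeasurePreserving ψ (lam.map τ) (lam.map τ) := by
  refine ⟨hψ, ?_⟩
  have hτ' : AEMeasurable τ (lam.map f) := by rwa [hf.map_eq]
  rw [AEMeasurable.map_map_of_aemeasurable hψ.aemeasurable hτ]
  have h1 : ψ ∘ τ =ᵐ[lam] τ ∘ f := h.mono fun x hx => hx.symm
  rw [Measure.map_congr h1, ← AEMeasurable.map_map_of_aemeasurable hτ' hf.measurable.aemeasurable,
    hf.map_eq]

variable [TopologicalSpace B] [SecondCountableTopology B] [BorelSpace B] {φ : Flow ℝ B}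
  [IsProbabilityMeasure lam]

/-- A property true almost everywhere is true at almost every time along almost every orbit. -/
theorem ae_ae_flow (hφ : ∀ t, MeasurePreserving (φ t) lam lam) {p : B → Prop}
    (hp : ∀ᵐ x ∂lam, p x) : ∀ᵐ x ∂lam, ∀ᵐ t : ℝ, p (φ t x) := by
  obtain ⟨Z, hZ, hZm, hZ0⟩ := exists_measurable_superset_of_null (ae_iff.1 hp)
  -- By invariance every time slice is null; Fubini then exchanges points and times.
  have h1 : ∀ᵐ q ∂((volume : Measure ℝ).prod lam), φ q.1 q.2 ∉ Z := by
    have hm : MeasurableSet {q : ℝ × B | φ q.1 q.2 ∈ Z} := by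
      have : Continuous fun q : ℝ × B => φ q.1 q.2 := by fun_prop
      exact this.measurable hZm
    rw [ae_iff]
    simp only [not_not]
    rw [Measure.measure_prod_null hm]
    refine ae_of_all _ fun t => ?_
    exact ((hφ t).measure_preimage hZm.nullMeasurableSet).trans hZ0
  have h2 : ∀ᵐ q ∂(lam.prod (volume : Measure ℝ)), φ q.2 q.1 ∉ Z :=
    Measure.measurePreserving_swap.quasiMeasurePreserving.ae h1
  filter_upwards [Measure.ae_ae_of_ae_prod h2] with x hx
  filter_upwards [hx] with t ht
  by_contra h
  exact ht (hZ h)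

/-- Since τ is only almost everywhere measurable, the ergodic theorem is applied to a measurable
modification, which agrees with τ at almost every time along almost every orbit and so has the same
averages. -/
theorem ae_tendsto_timeAverage_section {M : Type*} [TopologicalSpace M]
    [SecondCountableTopology M] [MeasurableSpace M] [BorelSpace M] {τ : B → M}
    (hφ : IsErgodicInvariant φ lam) (hτ : AEMeasurable τ lam) (ψ : ℝ → M → M)
    (hψ : ∀ᵐ x ∂lam, ∀ t, τ (φ t x) = ψ t (τ x)) :
    ∀ᵐ x ∂lam, τ x ∈ basin ψ (lam.map τ) := by
  filter_upwards [ae_forall_tendsto_timeAverage (M := M) hφ hτ.measurable_mk, hψ,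
    ae_ae_flow hφ.invariant hτ.ae_eq_mk] with x h1 h2 h3 h hh hs
  obtain ⟨C, hC⟩ := hs.exists_bound_of_continuous hh
  have h4 := h1 h hh C hC
  rw [← Measure.map_congr hτ.ae_eq_mk] at h4
  refine h4.congr fun T => ?_
  congr 1
  refine intervalIntegral.integral_congr_ae (h3.mono fun t ht _ => ?_)
  rw [← h2 t, ht]

end Equivariant

/-! ### Sections of largest expansion -/

section LargestExpansion

variable {d m : ℕ} {B : Type*} [TopologicalSpace B] {x₀ : B}
  {ρ : FundamentalGroup B x₀ →* GL (Fin (m + 1)) ℂ}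

/-- The projectivisation of the non-zero vectors of the flat bundle is continuous. -/
theorem HermitianMetric.exists_continuous_projectivization (N : HermitianMetric ρ) :
    ∃ P : {e : FlatBundle ρ // N.norm e ≠ 0} → ProjBundle ρ, Continuous P ∧
      ∀ b w (hw : w ≠ 0) (h : N.norm (Suspension.mk ρ b w) ≠ 0),
        P ⟨Suspension.mk ρ b w, h⟩
          = Suspension.mk (projRep ρ) b (Projectivization.mk ℂ w hw) := by
  have hne : ∀ b w, N.norm (Suspension.mk ρ b w) ≠ 0 → w ≠ 0 := by
    rintro b w h rfl
    have := N.norm_smul b 0 0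
    rw [zero_smul, norm_zero, zero_mul] at this
    exact h this
  have hex : ∀ e : {e : FlatBundle ρ // N.norm e ≠ 0}, ∃ p : UniversalCover B x₀ ×
      {w : Fin (m + 1) → ℂ // w ≠ 0}, Suspension.mk ρ p.1 p.2.1 = e.1 := by
    rintro ⟨e, he⟩
    obtain ⟨b, w, rfl⟩ := Suspension.exists_mk e
    exact ⟨⟨b, w, hne b w he⟩, rfl⟩
  choose p hp using hex
  let P : {e : FlatBundle ρ // N.norm e ≠ 0} → ProjBundle ρ := fun e =>
    Suspension.mk (projRep ρ) (p e).1 (Projectivization.mk ℂ (p e).2.1 (p e).2.2)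
  have hP : ∀ b w (hw : w ≠ 0) (h : N.norm (Suspension.mk ρ b w) ≠ 0),
      P ⟨Suspension.mk ρ b w, h⟩ = Suspension.mk (projRep ρ) b (Projectivization.mk ℂ w hw) :=
    fun b w hw h => mk_projRep_eq_of_mk_eq _ _ (hp ⟨_, h⟩)
  refine ⟨P, ?_, hP⟩
  have hq : IsQuotientMap fun p : UniversalCover B x₀ × (Fin (m + 1) → ℂ) =>
      Suspension.mk ρ p.1 p.2 :=
    Suspension.isOpenMap_mk.isQuotientMap Suspension.continuous_mk fun e => by
      obtain ⟨b, w, h⟩ := Suspension.exists_mk e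
      exact ⟨(b, w), h⟩
  have hO : IsOpen {e : FlatBundle ρ | N.norm e ≠ 0} :=
    isOpen_ne_fun N.continuous_norm continuous_const
  -- A quotient map restricts to one over an open set, so continuity is checked upstairs, where the
  -- arbitrary choice of representatives disappears.
  refine (hq.restrictPreimage_isOpen hO).continuous_iff.2 ?_
  have h1 : Continuous fun q : (fun p : UniversalCover B x₀ × (Fin (m + 1) → ℂ) =>
      Suspension.mk ρ p.1 p.2) ⁻¹' {e : FlatBundle ρ | N.norm e ≠ 0} =>
      (⟨q.1.2, hne _ _ q.2⟩ : {w : Fin (m + 1) → ℂ // w ≠ 0}) :=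
    (continuous_snd.comp continuous_subtype_val).subtype_mk _
  have h2 := Suspension.continuous_mk (ρ := projRep ρ) |>.comp
    ((continuous_fst.comp continuous_subtype_val).prodMk (continuous_projectivization_mk.comp h1))
  exact h2.congr fun q => (hP _ _ _ q.2).symm

variable [PathConnectedSpace B]

theorem Fiber.exists_linearParam_eq {x : B} (b : UniversalCover B x₀) (hb : b.pt = x)
    (e : Fiber ρ x) : ∃ w, Fiber.linearParam ρ b hb w = e :=
  (Fiber.linearParam ρ b hb).surjective e

variable [MeasurableSpace B] {φ : Flow ℝ B} {N : HermitianMetric ρ} {A : Set B}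
  {F G : ∀ x, Submodule ℂ (Fiber ρ x)} {σ : B → ProjBundle ρ}

section Splitting

variable {H : Type*} [TopologicalSpace H] [MeasureSpace H] [ChartedSpace H B]

/-- Over A, σ is the continuous projectivisation composed with the measurable generator of the line
F. -/
theorem IsLargestExpansionSplitting.measurable_section
    (hA : IsLargestExpansionSplitting H φ N A F G)
    (hσ : ∀ x ∈ A, ∀ (b : UniversalCover B x₀) (hb : b.pt = x) (w : Fin (m + 1) → ℂ) (hw : w ≠ 0),
      Fiber.linearParam ρ b hb w ∈ F x →
        σ x = Suspension.mk (projRep ρ) b (Projectivization.mk ℂ w hw)) :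
    Measurable fun x : A => σ x := by
  obtain ⟨P, hPc, hP⟩ := N.exists_continuous_projectivization
  obtain ⟨s, hs, hF⟩ := hA.measurable_fst
  have hex : ∀ x ∈ A, ∃ b w, w ≠ 0 ∧ (s 0 x).1 = Suspension.mk ρ b w ∧
      ∀ hw : w ≠ 0, σ x = Suspension.mk (projRep ρ) b (Projectivization.mk ℂ w hw) := by
    intro x hx
    obtain ⟨b, hb⟩ := UniversalCover.exists_pt_eq (x₀ := x₀) x
    obtain ⟨w, hw⟩ := Fiber.exists_linearParam_eq b hb (s 0 x)
    refine ⟨b, w, ?_, by rw [← hw]; rfl, fun hw0 => hσ x hx b hb w hw0 ?_⟩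
    · rintro rfl
      rw [map_zero] at hw
      exact (hF x hx).1.ne_zero 0 hw.symm
    · rw [hw, ← (hF x hx).2]
      exact Submodule.subset_span ⟨0, rfl⟩
  have hne : ∀ x : A, N.norm (s 0 x.1).1 ≠ 0 := by
    intro x
    obtain ⟨b, w, hw, h1, -⟩ := hex x.1 x.2
    rw [h1]
    exact (N.norm_pos b hw).ne'
  have h2 : (fun x : A => σ x) = fun x : A => P ⟨(s 0 x.1).1, hne x⟩ := by
    ext x
    obtain ⟨b, w, hw, h1, h2⟩ := hex x.1 x.2
    have h3 : (⟨(s 0 x.1).1, hne x⟩ : {e : FlatBundle ρ // N.norm e ≠ 0})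
        = ⟨Suspension.mk ρ b w, h1 ▸ hne x⟩ := Subtype.ext h1
    rw [h3, hP b w hw, h2 hw]
  rw [h2]
  exact hPc.measurable.comp ((hs 0).subtype_mk)

/-- The lifted flow fixes the vector coordinate w and F is invariant, so a generator of F at x is
carried to one at φ t x. -/
theorem IsLargestExpansionSplitting.section_flow
    (hA : IsLargestExpansionSplitting H φ N A F G)
    (hσ : ∀ x ∈ A, ∀ (b : UniversalCover B x₀) (hb : b.pt = x) (w : Fin (m + 1) → ℂ) (hw : w ≠ 0),
      Fiber.linearParam ρ b hb w ∈ F x →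
        σ x = Suspension.mk (projRep ρ) b (Projectivization.mk ℂ w hw))
    (t : ℝ) {x : B} (hx : x ∈ A) : σ (φ t x) = Suspension.flow φ t (σ x) := by
  obtain ⟨b, rfl⟩ := UniversalCover.exists_pt_eq (x₀ := x₀) x
  have hnt : F b.pt ≠ ⊥ := fun h => by
    have := hA.finrank_eq_one _ hx
    rw [h, finrank_bot] at this
    exact zero_ne_one this
  obtain ⟨e, he, he0⟩ := Submodule.exists_mem_ne_zero_of_ne_bot hnt
  obtain ⟨w, rfl⟩ := Fiber.exists_linearParam_eq b rfl e
  have hw : w ≠ 0 := by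
    rintro rfl
    exact he0 (map_zero _)
  rw [hσ _ hx b rfl w hw he, Suspension.flow_mk]
  refine hσ _ (hA.invariant t _ hx) (UniversalCover.flow φ t b) rfl w hw ?_
  have h1 : Fiber.flow φ t (Fiber.linearParam ρ b rfl w) ∈ (F (φ t b.pt) : Set _) := by
    rw [hA.flow_fst t _ hx]
    exact ⟨_, he, rfl⟩
  exact h1

end Splitting

end LargestExpansion

/-! ### The basin has total Lebesgue measure. -/

section Basin

variable {d m : ℕ} {B : Type*} [TopologicalSpace B] {x₀ : B}
  {ρ : FundamentalGroup B x₀ →* GL (Fin (m + 1)) ℂ} [PathConnectedSpace B] [MeasurableSpace B]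
  [ChartedSpace (EuclideanSpace ℝ (Fin d)) B] {φ : Flow ℝ B} {N : HermitianMetric ρ} {A : Set B}
  {F G : ∀ x, Submodule ℂ (Fiber ρ x)} {σ : B → ProjBundle ρ}

theorem mem_basin_of_tendsto_sub {M : Type*} [TopologicalSpace M] [MeasurableSpace M]
    {ψ : ℝ → M → M} {μ : Measure M} {y z : M} (hz : z ∈ basin ψ μ)
    (hyc : Continuous fun t => ψ t y) (hzc : Continuous fun t => ψ t z)
    (h : ∀ f : M → ℝ, Continuous f → HasCompactSupport f →
      Tendsto (fun t => f (ψ t y) - f (ψ t z)) atTop (𝓝 0)) : y ∈ basin ψ μ := by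
  intro f hf hs
  obtain ⟨C, hC⟩ := hs.exists_bound_of_continuous hf
  exact tendsto_timeAverage_of_sub_tendsto_zero (hf.comp hzc).measurable (hf.comp hyc).measurable
    (fun t => hC _) (fun t => hC _) (h f hf hs) (hz f hf hs)

/-- The F-component of w is non-zero since w ∉ G, so it represents σ at the base point, and the
orbit of the class of w is asymptotic to that of σ. -/
theorem IsLargestExpansionSplitting.mem_basin
    (hA : IsLargestExpansionSplitting (EuclideanSpace ℝ (Fin d)) φ N A F G)
    (hσ : ∀ x ∈ A, ∀ (b : UniversalCover B x₀) (hb : b.pt = x) (w : Fin (m + 1) → ℂ) (hw : w ≠ 0),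
      Fiber.linearParam ρ b hb w ∈ F x →
        σ x = Suspension.mk (projRep ρ) b (Projectivization.mk ℂ w hw))
    {μ : Measure (ProjBundle ρ)} (b : UniversalCover B x₀) (hb : b.pt ∈ A)
    (hμ : σ b.pt ∈ basin (Suspension.flow φ) μ) {w : Fin (m + 1) → ℂ} (hw : w ≠ 0)
    (hwG : Fiber.linearParam ρ b rfl w ∉ G b.pt) :
    Suspension.mk (projRep ρ) b (Projectivization.mk ℂ w hw) ∈ basin (Suspension.flow φ) μ := by
  obtain ⟨e₁, he₁, e₂, he₂, he⟩ := Submodule.mem_sup.1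
    ((hA.isCompl _ hb).sup_eq_top.symm ▸ Submodule.mem_top :
      Fiber.linearParam ρ b rfl w ∈ F b.pt ⊔ G b.pt)
  obtain ⟨w₁, rfl⟩ := Fiber.exists_linearParam_eq b rfl e₁
  obtain ⟨w₂, rfl⟩ := Fiber.exists_linearParam_eq b rfl e₂
  rw [← map_add] at he
  obtain rfl := (Fiber.linearParam ρ b rfl).injective he
  have hw₁ : w₁ ≠ 0 := by
    rintro rfl
    rw [zero_add] at hwG
    exact hwG he₂
  have hσb := hσ _ hb b rfl w₁ hw₁ he₁
  refine mem_basin_of_tendsto_sub hμ (Suspension.continuous_flow_time φ _)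
    (Suspension.continuous_flow_time φ _) fun f hf hs => ?_
  rw [hσb]
  refine tendsto_sub_of_expansion d φ N b hw₁ hw (fun hw₂ K hK t ht htK => ?_) hf hs
  exact hA.expansion _ hb K hK t ht htK _ he₁ ((map_ne_zero_iff _
    (Fiber.linearParam ρ b rfl).injective).2 hw₁) _ he₂ ((map_ne_zero_iff _
    (Fiber.linearParam ρ b rfl).injective).2 hw₂)

omit [PathConnectedSpace B] in
theorem measurableSet_chartBall_preimage [BorelSpace B] (x : B) {A' : Set B}
    (hA' : MeasurableSet A') : MeasurableSet {u : EuclideanSpace ℝ (Fin d) |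
      u ∈ chartBall d x ∧ (chartAt (EuclideanSpace ℝ (Fin d)) x).symm u ∈ A'} := by
  have h1 : Continuous ((chartBall d x).domRestrict
      (chartAt (EuclideanSpace ℝ (Fin d)) x).symm) :=
    continuousOn_iff_continuous_domRestrict.1
      ((chartAt (EuclideanSpace ℝ (Fin d)) x).symm.continuousOn.mono (chartBall_subset x))
  have h2 := (isOpen_chartBall (d := d) x).measurableSet.subtype_image (h1.measurable hA')
  convert h2 using 1
  ext u
  exact ⟨fun ⟨h3, h4⟩ => ⟨⟨u, h3⟩, h4, rfl⟩, fun ⟨⟨z, h3⟩, h4, h5⟩ => h5 ▸ ⟨h3, h4⟩⟩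

/-- The coordinates of a measurable section in a local trivialisation. -/
theorem exists_measurable_coordinates [BorelSpace B] {s : ∀ x, Fiber ρ x}
    (hs : Measurable fun x : A => (s x).1) {A' : Set B} (hA' : MeasurableSet A') (hAA : A' ⊆ A)
    (b : UniversalCover B x₀) :
    ∃ v : EuclideanSpace ℝ (Fin d) → Fin (m + 1) → ℂ, Measurable v ∧
      ∀ (u : EuclideanSpace ℝ (Fin d)) (hu : u ∈ chartBall d b.pt),
        (chartAt (EuclideanSpace ℝ (Fin d)) b.pt).symm u ∈ A' →
          Fiber.linearParam ρ (localLift b ⟨u, hu⟩) (localLift_pt b ⟨u, hu⟩) (v u)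
            = s ((chartAt (EuclideanSpace ℝ (Fin d)) b.pt).symm u) := by
  let D : Set (EuclideanSpace ℝ (Fin d)) := {u | u ∈ chartBall d b.pt ∧
    (chartAt (EuclideanSpace ℝ (Fin d)) b.pt).symm u ∈ A'}
  have hD : MeasurableSet D := measurableSet_chartBall_preimage b.pt hA'
  have hex : ∀ u : D, ∃ w : Fin (m + 1) → ℂ,
      Fiber.linearParam ρ (localLift b ⟨u.1, u.2.1⟩) (localLift_pt b ⟨u.1, u.2.1⟩) w
        = s ((chartAt (EuclideanSpace ℝ (Fin d)) b.pt).symm u) := fun u =>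
    Fiber.exists_linearParam_eq (localLift b ⟨u.1, u.2.1⟩) (localLift_pt b ⟨u.1, u.2.1⟩) _
  choose w hw using hex
  have hemb := (isOpenEmbedding_mk_localLift (d := d) (X := Fin (m + 1) → ℂ) ρ b).measurableEmbedding
  have h1 : Measurable fun u : D => (chartAt (EuclideanSpace ℝ (Fin d)) b.pt).symm u.1 :=
    (continuousOn_iff_continuous_domRestrict.1
      ((chartAt (EuclideanSpace ℝ (Fin d)) b.pt).symm.continuousOn.mono
        fun u hu => chartBall_subset b.pt (And.left hu : u ∈ chartBall d b.pt))).measurable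
  have h2 : Measurable fun u : D =>
      (s ((chartAt (EuclideanSpace ℝ (Fin d)) b.pt).symm u.1)).1 :=
    hs.comp (h1.subtype_mk (h := fun u => hAA u.2.2))
  -- Though w was chosen pointwise, the local trivialisation is a measurable embedding whose
  -- composite with this map is s, so w is measurable.
  have h3 : Measurable fun u : D => ((⟨u.1, u.2.1⟩ : chartBall d b.pt), w u) := by
    refine hemb.measurable_comp_iff.1 ?_
    convert h2 using 1
    exact funext fun u => congrArg Subtype.val (hw u)
  obtain ⟨v, hv, hvw⟩ := (MeasurableEmbedding.subtype_coe hD).exists_measurable_extend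
    (measurable_snd.comp h3) fun _ => ⟨0⟩
  refine ⟨v, hv, fun u hu hu' => ?_⟩
  have h4 : v u = w ⟨u, hu, hu'⟩ := congrFun hvw ⟨u, hu, hu'⟩
  rw [h4]
  exact hw ⟨u, hu, hu'⟩

omit [MeasurableSpace B] in
theorem Fiber.frame_coordinates {x : B} (c : UniversalCover B x₀) (hc : c.pt = x)
    {w : Fin m → Fin (m + 1) → ℂ} {s : Fin m → Fiber ρ x}
    (hw : ∀ j, Fiber.linearParam ρ c hc (w j) = s j) (hs : LinearIndependent ℂ s) :
    LinearIndependent ℂ w ∧ ∀ z, Fiber.linearParam ρ c hc z ∈ Submodule.span ℂ (range s) →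
      z ∈ Submodule.span ℂ (range w) := by
  obtain rfl : (Fiber.linearParam ρ c hc).toLinearMap ∘ w = s := funext hw
  refine ⟨hs.of_comp _, fun z hz => ?_⟩
  rw [range_comp, ← Submodule.map_span] at hz
  obtain ⟨y, hy, hyz⟩ := hz
  rwa [← (Fiber.linearParam ρ c hc).injective hyz]

/-- In a chart, a point outside S either lies over the complement of A', a null set times ℂᵐ, or
over A' and in the hyperplane of G. The set A' stands in for A, which need not be Borel. -/
theorem IsLargestExpansionSplitting.lebesgueNull_compl [BorelSpace B]
    (hA : IsLargestExpansionSplitting (EuclideanSpace ℝ (Fin d)) φ N A F G) {A' : Set B}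
    (hA' : MeasurableSet A') (hAA : A' ⊆ A)
    (hnull : LebesgueNull (EuclideanSpace ℝ (Fin d)) A'ᶜ) {S : Set (ProjBundle ρ)}
    (hS : ∀ b : UniversalCover B x₀, b.pt ∈ A' → ∀ w (hw : w ≠ 0),
      Fiber.linearParam ρ b rfl w ∉ G b.pt →
        Suspension.mk (projRep ρ) b (Projectivization.mk ℂ w hw) ∈ S) :
    LebesgueNull (EuclideanSpace ℝ (Fin d) × (Fin m → ℂ)) Sᶜ := by
  rintro _ ⟨⟨b, i⟩, rfl⟩
  dsimp only
  rw [Suspension.chart_image]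
  obtain ⟨s, hs, hsG⟩ := hA.measurable_snd
  choose v hv hvs using fun j => exists_measurable_coordinates (d := d) (hs j) hA' hAA b
  have hspan : ∀ u (hu : u ∈ chartBall d b.pt),
      (chartAt (EuclideanSpace ℝ (Fin d)) b.pt).symm u ∈ A' →
      LinearIndependent ℂ (fun j => v j u) ∧ ∀ z, Fiber.linearParam ρ (localLift b ⟨u, hu⟩)
        (localLift_pt b ⟨u, hu⟩) z ∈ G ((chartAt (EuclideanSpace ℝ (Fin d)) b.pt).symm u) →
          z ∈ Submodule.span ℂ (range fun j => v j u) := by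
    intro u hu hu'
    obtain ⟨h1, h2⟩ := hsG _ (hAA hu')
    rw [← h2]
    exact Fiber.frame_coordinates _ _ (fun j => hvs j u hu hu') h1
  have h0 : volume {u : EuclideanSpace ℝ (Fin d) | u ∈ chartBall d b.pt ∧
      (chartAt (EuclideanSpace ℝ (Fin d)) b.pt).symm u ∉ A'} = 0 := by
    refine measure_mono_null ?_ (hnull _ (chart_mem_atlas (EuclideanSpace ℝ (Fin d)) b.pt))
    rintro u ⟨hu, hu'⟩
    exact ⟨_, ⟨hu', (chartAt _ b.pt).map_target (chartBall_subset b.pt hu)⟩,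
      (chartAt _ b.pt).right_inv (chartBall_subset b.pt hu)⟩
  have h1 : volume ({u : EuclideanSpace ℝ (Fin d) | u ∈ chartBall d b.pt ∧
      (chartAt (EuclideanSpace ℝ (Fin d)) b.pt).symm u ∉ A'} ×ˢ (univ : Set (Fin m → ℂ))) = 0 := by
    rw [Measure.volume_eq_prod, Measure.prod_prod, h0, zero_mul]
  have h2 := volume_setOf_insertNth_mem_span i hv
    (measurableSet_chartBall_preimage (d := d) b.pt hA') fun u hu => (hspan u hu.1 hu.2).1
  refine measure_mono_null ?_ (measure_union_null h1 h2)
  rintro ⟨u, z⟩ ⟨hu, hz⟩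
  by_cases hu' : (chartAt (EuclideanSpace ℝ (Fin d)) b.pt).symm u ∈ A'
  · refine Or.inr ⟨⟨hu, hu'⟩, ?_⟩
    by_contra hzG
    refine hz (hS (localLift b ⟨u, hu⟩) hu' _ (insertNth_one_ne_zero i z) fun h => hzG ?_)
    exact (hspan u hu hu').2 _ h
  · exact Or.inl ⟨⟨hu, hu'⟩, mem_univ _⟩

omit [MeasurableSpace B] in
theorem not_lebesgueNull_univ :
    ¬ LebesgueNull (EuclideanSpace ℝ (Fin d) × (Fin m → ℂ)) (univ : Set (ProjBundle ρ)) := by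
  intro h
  obtain ⟨b, -⟩ := UniversalCover.exists_pt_eq (x₀ := x₀) x₀
  have h1 := h (Suspension.chart (projRep ρ) b 0) ⟨(b, 0), rfl⟩
  rw [Suspension.chart_image] at h1
  have h2 : (chartBall d b.pt) ×ˢ (univ : Set (Fin m → ℂ)) ⊆ _ :=
    fun p hp => (⟨hp.1, trivial⟩ : ∃ hu : p.1 ∈ chartBall d b.pt,
      Suspension.chartParam (d := d) (projRep ρ) b 0 (⟨p.1, hu⟩, p.2) ∈ univ)
  exact (((isOpen_chartBall b.pt).prod isOpen_univ).measure_pos volume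
    ⟨(_, 0), center_mem_chartBall b.pt, mem_univ _⟩).ne' (measure_mono_null h2 h1)

end Basin

/-! ### Proof of the theorem. -/

theorem mainTheorem2 {d m : ℕ} {B : Type*} [TopologicalSpace B] [T2Space B]
    [SecondCountableTopology B] [PathConnectedSpace B]
    [ChartedSpace (EuclideanSpace ℝ (Fin d)) B] [IsManifold (𝓡 d) 1 B]
    [MeasurableSpace B] [BorelSpace B] (φ : Flow ℝ B)
    (lam : Measure B) [IsProbabilityMeasure lam] (hlam : IsErgodicInvariant φ lam)
    (hdens : HasPositiveDensity (EuclideanSpace ℝ (Fin d)) lam)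
    (x₀ : B) (ρ : FundamentalGroup B x₀ →* GL (Fin (m + 1)) ℂ) (N : HermitianMetric ρ)
    (σ : B → ProjBundle ρ)
    (hσ : IsSectionOfLargestExpansion (EuclideanSpace ℝ (Fin d)) φ N σ) :
    IsSRBMeasure (EuclideanSpace ℝ (Fin d) × (Fin m → ℂ)) (Suspension.flow φ) (lam.map σ) ∧
      LebesgueNull (EuclideanSpace ℝ (Fin d) × (Fin m → ℂ))
        (basin (Suspension.flow φ) (lam.map σ))ᶜ := by
  obtain ⟨A, F, G, hA, hσ⟩ := hσ
  have := secondCountableTopology_projectivization m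
  have := secondCountableTopology_suspension d (X := ℙ ℂ (Fin (m + 1) → ℂ)) (projRep ρ)
  have hlamA : lam Aᶜ = 0 := hdens.measure_eq_zero hA.total
  have haeA : ∀ᵐ x ∂lam, x ∈ A := mem_ae_iff.2 hlamA
  have hσm : AEMeasurable σ lam := by
    -- A measurable subset of A of full measure, on which σ is measurable; elsewhere σ is arbitrary.
    obtain ⟨Z, hZ, hZm, hZ0⟩ := exists_measurable_superset_of_null hlamA
    have hZA : Zᶜ ⊆ A := compl_subset_comm.1 hZ
    have h1 := (hA.measurable_section hσ).comp (measurable_inclusion hZA)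
    have h2 := aemeasurable_restrict_of_measurable_subtype (μ := lam) hZm.compl h1
    have h3 : ∀ᵐ x ∂lam, x ∈ Zᶜ := measure_eq_zero_iff_ae_notMem.1 hZ0
    rwa [Measure.restrict_eq_self_of_ae_mem h3] at h2
  have hflow : ∀ᵐ x ∂lam, ∀ t, σ (φ t x) = Suspension.flow φ t (σ x) :=
    haeA.mono fun x hx t => hA.section_flow hσ t hx
  have hgen := ae_tendsto_timeAverage_section hlam hσm (Suspension.flow φ) hflow
  obtain ⟨Z, hZ, hZm, hZ0⟩ := exists_measurable_superset_of_null (ae_iff.1 (haeA.and hgen))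
  have hgood : ∀ x ∈ Zᶜ, x ∈ A ∧ σ x ∈ basin (Suspension.flow φ) (lam.map σ) := fun x hx => by
    by_contra h
    exact hx (hZ h)
  have hnull : LebesgueNull (EuclideanSpace ℝ (Fin d) × (Fin m → ℂ))
      (basin (Suspension.flow φ) (lam.map σ))ᶜ :=
    hA.lebesgueNull_compl hZm.compl (fun x hx => (hgood x hx).1)
      (hdens.lebesgueNull (by rwa [compl_compl]))
      fun b hb w hw hwG => hA.mem_basin hσ b (hgood _ hb).1 (hgood _ hb).2 hw hwG
  refine ⟨⟨Measure.isProbabilityMeasure_map hσm, fun t => ?_, fun h => ?_⟩, hnull⟩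
  · exact measurePreserving_map_section hσm (Suspension.continuous_flow φ t).measurable
      (hlam.invariant t) (hflow.mono fun x hx => hx t)
  -- Were the basin null, it and its null complement would make the whole manifold null.
  · refine not_lebesgueNull_univ (d := d) (ρ := ρ) fun e he => ?_
    rw [← union_compl_self (basin (Suspension.flow φ) (lam.map σ)), union_inter_distrib_right,
      image_union]
    exact measure_union_null (h e he) (hnull e he)
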